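/- Let $(Y,d)$ be a proper geodesic metric space and let $G$ be a group acting properly and by isometries on $Y$. Assume that $G$ is non-elementary (no finite-index subgroup of $G$ is trivial or isomorphic to $\mathbb Z$). A subset $X\subset Y$ is *$C$-contracting* ($C\ge 1$) if for every geodesic $\gamma$ in $Y$ with $d(\gamma,X)\ge C$, the set of all points of $X$ that are nearest points of $X$ to some point of $\gamma$ has diameter at most $C$; it is *contracting* if this holds for some $C\ge 1$. An element $h\in G$ is *contracting* if for some $y\in Y$ the orbit $\{h^n y: n\in\mathbb Z\}$ is contracting and the map $\mathbb Z\to Y$, $n\mapsto h^n y$, is a quasi-isometric embedding. A path in $Y$ is a *$c$-quasi-geodesic* ($c\ge 1$) if every subpath $\beta$ of it, with endpoints $\beta_-,\beta_+$, has length at most $c\,d(\beta_-,\beta_+)+c$. For $o\in Y$ and $\Gamma\subset G$, the *critical exponent* is $$\omega(\Gamma)=\limsup_{n\to\infty}\frac{\log \sharp\{g\in\Gamma : d(o,go)\le n\}}{n}\in[-\infty,\infty].$$ **Theorem (large free semigroups).** Assume in addition that $G$ contains a contracting element, and fix a basepoint $o\in Y$. Then there is a sequence of free sub-semigroups $\Gamma_n\subset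 G$ such that: 1. $\omega(\Gamma_n)<\omega(G)$ for every $n$, and $\omega(\Gamma_n)\to\omega(G)$ as $n\to\infty$. 2. Each $\Gamma_n$ is freely generated by a non-empty set $S_n\subset G$ such that the following holds. Let $\mathcal T_n$ be the Cayley graph of $\Gamma_n$ with respect to $S_n$, with the identity adjoined as root: its vertex set is $\Gamma_n\cup\{1\}$, and $g$ is joined to $gs$ for every $s\in S_n$. Then $\mathcal T_n$ is a tree, and the orbital map $g\mapsto go$ is a quasi-isometric embedding of its vertex set, with the graph metric, into $Y$. Extend the orbital map to the edges by choosing, for every $s\in S_n$, a geodesic $[o,so]$ and sending the edge from $g$ to $gs$ to $g[o,so]$. For any such choice there are constants $c\ge 1$ and $C\ge 1$ such that the image of every branch of $\mathcal T_n$ (the infinite path $1,\,s_0,\,s_0s_1,\,s_0s_1s_2,\dots$ given by a sequence $(s_k)_{k\ge 0}$ in $S_n$), which is a path starting at $o$, is a $c$-quasi-geodesic and a $C$-contracting subset of $Y$. -/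

import Mathlib

open Filter Topology Set

/-- `γ` restricted to `I` is a geodesic (parametrised by arc length). With `I` order-connected this
covers geodesic segments, rays and lines. -/
def IsGeodesicOn {Y : Type*} [MetricSpace Y] (γ : ℝ → Y) (I : Set ℝ) : Prop :=
  ∀ s ∈ I, ∀ t ∈ I, dist (γ s) (γ t) = |s - t|

/-- `γ` on `[0, d(x, y)]` is a geodesic segment from `x` to `y`. -/
def IsGeodesicSegment {Y : Type*} [MetricSpace Y] (γ : ℝ → Y) (x y : Y) : Prop :=
  IsGeodesicOn γ (Icc 0 (dist x y)) ∧ γ 0 = x ∧ γ (dist x y) = y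

/-- Any two points are joined by a geodesic segment. -/
def IsGeodesicSpace (Y : Type*) [MetricSpace Y] : Prop :=
  ∀ x y : Y, ∃ γ : ℝ → Y, IsGeodesicSegment γ x y

/-- The set of points of `X` that are nearest to some point of `A`. -/
def nearestPointProjection {Y : Type*} [MetricSpace Y] (X A : Set Y) : Set Y :=
  {x | x ∈ X ∧ ∃ a ∈ A, dist a x = Metric.infDist a X}

/-- `X` is `C`-contracting (with respect to all geodesics): every geodesic at distance at least `C`
from `X` has a projection to `X` of diameter at most `C`. -/
def IsContractingWith {Y : Type*} [MetricSpace Y] (C : ℝ) (X : Set Y) : Prop :=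
  ∀ (γ : ℝ → Y) (I : Set ℝ), I.OrdConnected → IsGeodesicOn γ I →
    (∀ p ∈ γ '' I, ∀ x ∈ X, C ≤ dist p x) →
    ∀ x ∈ nearestPointProjection X (γ '' I), ∀ y ∈ nearestPointProjection X (γ '' I), dist x y ≤ C

/-- `f` is a quasi-isometric embedding of `A`, with the distance function `ρ`, into `Y`. -/
def IsQuasiIsometricEmbedding {A Y : Type*} [MetricSpace Y] (ρ : A → A → ℝ) (f : A → Y) : Prop :=
  ∃ K : ℝ, 1 ≤ K ∧ ∃ c : ℝ, 0 ≤ c ∧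
    ∀ a b : A, ρ a b / K - c ≤ dist (f a) (f b) ∧ dist (f a) (f b) ≤ K * ρ a b + c

/-- `h` is a contracting element: for some basepoint the orbit of `⟨h⟩` is a contracting subset and
`n ↦ hⁿ o` is a quasi-isometric embedding of `ℤ`. -/
def IsContractingElement {G : Type*} [Group G] (Y : Type*) [MetricSpace Y] [MulAction G Y]
    (h : G) : Prop :=
  ∃ o : Y, (∃ C : ℝ, 1 ≤ C ∧ IsContractingWith C (range fun n : ℤ => h ^ n • o)) ∧
    IsQuasiIsometricEmbedding (fun m n : ℤ => |(m : ℝ) - n|) (fun n : ℤ => h ^ n • o)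

/-- No finite-index subgroup is trivial or infinite cyclic. -/
def IsNonElementary (G : Type*) [Group G] : Prop :=
  ∀ H : Subgroup G, H.FiniteIndex → H ≠ ⊥ ∧ ¬ Nonempty (H ≃* Multiplicative ℤ)

/-- The ball `N(o, r)` in the group. -/
def orbitBall {G Y : Type*} [Group G] [MetricSpace Y] [MulAction G Y] (o : Y) (r : ℝ) : Set G :=
  {g | dist o (g • o) ≤ r}

/-- The critical exponent `limsup_{n → ∞} log #(N(o, n) ∩ Γ) / n`, with values in `[-∞, ∞]`. -/
noncomputable def criticalExponent {G Y : Type*} [Group G] [MetricSpace Y] [MulAction G Y]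
    (o : Y) (Γ : Set G) : EReal :=
  limsup (fun n : ℕ => ENNReal.log ((orbitBall o (n : ℝ) ∩ Γ).encard : ENNReal) / (n : EReal)) atTop

/-- `Γ` is a free semigroup with (non-empty) base `S`. -/
def IsFreeSemigroupOn {G : Type*} [Group G] (Γ : Subsemigroup G) (S : Set G) : Prop :=
  S.Nonempty ∧ Subsemigroup.closure S = Γ ∧
    Function.Injective (FreeSemigroup.lift (fun s : S => (s : G)))

/-- The (underlying undirected graph of the) Cayley graph of the semigroup `Γ` with respect to `S`,
with the identity adjoined as the root: `g` is joined to `g * s` for `s ∈ S`. -/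
def semigroupCayleyGraph {G : Type*} [Group G] (Γ : Subsemigroup G) (S : Set G) :
    SimpleGraph {g : G // g = 1 ∨ g ∈ Γ} :=
  SimpleGraph.fromRel fun g h => ∃ s ∈ S, (h : G) = g * s

/-- A choice of geodesic segments `[o, so]` for `s ∈ S`. -/
def IsGeodesicChoice {G Y : Type*} [Group G] [MetricSpace Y] [MulAction G Y] (o : Y) (S : Set G)
    (σ : S → ℝ → Y) : Prop :=
  ∀ s : S, IsGeodesicSegment (σ s) o ((s : G) • o)

/-- The orbital map on the edge from `g` to `g * s`, identified with `[0, 1]`: it runs at constant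
speed through the translate by `g` of the chosen geodesic `[o, so]`. -/
noncomputable def orbitalMapEdge {G Y : Type*} [Group G] [MetricSpace Y] [MulAction G Y] (o : Y)
    {S : Set G} (σ : S → ℝ → Y) (g : G) (s : S) (t : ℝ) : Y :=
  g • σ s (t * dist o ((s : G) • o))

/-- The vertices `1, s₀, s₀s₁, s₀s₁s₂, …` of the branch `(s₀, s₁, s₂, …)` of the Cayley graph. -/
def branchVertex {G : Type*} [Group G] {S : Set G} (b : ℕ → S) : ℕ → G
  | 0 => 1
  | k + 1 => branchVertex b k * b k

/-- The image under the orbital map of the branch `b` starting at the root, as a path on `[0, ∞)`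
whose restriction to `[k, k + 1]` is the image of the `k`-th edge. -/
noncomputable def branchPath {G Y : Type*} [Group G] [MetricSpace Y] [MulAction G Y] (o : Y)
    {S : Set G} (σ : S → ℝ → Y) (b : ℕ → S) (t : ℝ) : Y :=
  orbitalMapEdge o σ (branchVertex b ⌊t⌋₊) (b ⌊t⌋₊) (t - ⌊t⌋₊)

/-- The path `γ` on the interval `I` is a `c`-quasi-geodesic: each subpath `β` has length at most
`c * d(β₋, β₊) + c`. The length of a path is its variation. -/
def IsQuasiGeodesicPath {Y : Type*} [MetricSpace Y] (c : ℝ) (γ : ℝ → Y) (I : Set ℝ) : Prop :=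
  ContinuousOn γ I ∧ ∀ a ∈ I, ∀ b ∈ I, a ≤ b →
    eVariationOn γ (Icc a b) ≤ ENNReal.ofReal (c * dist (γ a) (γ b) + c)

/-! The semigroups are generated by the products `a * f`, with `a` in a finite set `A` of elements
moving `o` by a distance in `(m, m + 1]` and `f` one fixed translation along a contracting axis `X`.
Contraction enters through one fact: a geodesic whose endpoints project more than `C` apart on `X`
passes within `2C` of both projections (`exists_dist_le_left`).

Suppose every `a⁻¹ • o` and `a • o` projects near `o`, the points `a • o` are separated, and `f`
moves `o` far along `X` (`IsPingPong`). In a word `a₁ f a₂ f ⋯` each occurrence of `f` then gives a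
translate of `X` on which the earlier and later parts of the word project to opposite ends. The
first letter can thus be read off from where the word sends `o`, so the semigroup is free
(`altProd_injOn`). A letter adds at least `ℓ - (2τ + 6C)` to the displacement
(`le_dist_altProd_cons`), and a geodesic whose nearest points on a branch are far apart meets such a
translate between them, hence comes close to the branch. This gives the tree, the quasi-isometric
embedding, the quasi-geodesic property and the contraction.

To find `f` and `A`: the commensurating subgroup of a contracting `h` has infinite index, as it is
virtually `⟨h⟩` and `G` is non-elementary. Hence there are three translates of the axis such that
any point projects far from `o` on at most one. For each `a`, one of the three is good for both `a •
o` and `a⁻¹ • o`; so a fixed proportion `1 / K` of any subset of any distant annulus plays ping-pong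
with one common axis, where `K`, `τ` and the bound on `d(o, f o)` do not depend on the annulus
(`exists_isPingPong`).

Given `a < b < c < ω(G)`, some distant annulus has more than `exp (b m)` elements. Keeping only
`⌈exp (b m)⌉` of them and then the ping-pong part gives a semigroup whose exponent is `b` up to
errors vanishing as `m → ∞`: at least `a` and at most `c < ω(G)`. Discarding the surplus elements is
what makes the inequality strict. -/

/-! ### Nearest points and contracting sets -/

section Geometry

variable {Y : Type*} [MetricSpace Y]

/-- `x` is a point of `X` nearest to `p`. -/
def IsNearestPoint (X : Set Y) (p x : Y) : Prop :=
  x ∈ X ∧ dist p x = Metric.infDist p X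

/-- `X` is `C`-contracting and every point of `Y` has a nearest point in `X`. -/
structure IsProximinalContracting (C : ℝ) (X : Set Y) : Prop where
  nonneg : 0 ≤ C
  contracting : IsContractingWith C X
  exists_nearest : ∀ p, ∃ x, IsNearestPoint X p x

theorem IsNearestPoint.dist_le {X : Set Y} {p x y : Y} (h : IsNearestPoint X p x) (hy : y ∈ X) :
    dist p x ≤ dist p y := by
  rw [h.2]; exact Metric.infDist_le_dist_of_mem hy

theorem isNearestPoint_iff {X : Set Y} {p x : Y} :
    IsNearestPoint X p x ↔ x ∈ X ∧ ∀ y ∈ X, dist p x ≤ dist p y := by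
  refine ⟨fun h => ⟨h.1, fun y hy => h.dist_le hy⟩, fun h => ⟨h.1, le_antisymm ?_ ?_⟩⟩
  · exact (Metric.le_infDist ⟨x, h.1⟩).2 fun y hy => h.2 y hy
  · exact Metric.infDist_le_dist_of_mem h.1

theorem isNearestPoint_self {X : Set Y} {x : Y} (h : x ∈ X) : IsNearestPoint X x x :=
  isNearestPoint_iff.2 ⟨h, fun y _ => by simp⟩

theorem IsGeodesicOn.mono {γ : ℝ → Y} {I J : Set ℝ} (h : IsGeodesicOn γ I) (hJ : J ⊆ I) :
    IsGeodesicOn γ J := fun s hs t ht => h s (hJ hs) t (hJ ht)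

theorem IsGeodesicOn.continuousOn {γ : ℝ → Y} {I : Set ℝ} (h : IsGeodesicOn γ I) :
    ContinuousOn γ I := by
  have : LipschitzOnWith 1 γ I := LipschitzOnWith.of_dist_le_mul fun s hs t ht => by
    rw [h s hs t ht, Real.dist_eq]; simp
  exact this.continuousOn

theorem IsGeodesicOn.reverse {γ : ℝ → Y} {a b : ℝ} (h : IsGeodesicOn γ (Icc a b)) :
    IsGeodesicOn (fun t => γ (a + b - t)) (Icc a b) := fun s hs t ht => by
  show dist (γ (a + b - s)) (γ (a + b - t)) = |s - t|
  rw [h _ ⟨by linarith [hs.2], by linarith [hs.1]⟩ _ ⟨by linarith [ht.2], by linarith [ht.1]⟩,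
    abs_sub_comm]
  congr 1; ring

theorem IsContractingWith.dist_le_of_geodesic {C : ℝ} {X : Set Y} (hX : IsContractingWith C X)
    {γ : ℝ → Y} {a b : ℝ} (hab : a ≤ b) (hγ : IsGeodesicOn γ (Icc a b))
    (hfar : ∀ t ∈ Icc a b, C ≤ Metric.infDist (γ t) X) {x y : Y}
    (hx : IsNearestPoint X (γ a) x) (hy : IsNearestPoint X (γ b) y) : dist x y ≤ C := by
  refine hX γ (Icc a b) ordConnected_Icc hγ ?_ x ⟨hx.1, γ a, ⟨a, ⟨le_rfl, hab⟩, rfl⟩, hx.2⟩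
    y ⟨hy.1, γ b, ⟨b, ⟨hab, le_rfl⟩, rfl⟩, hy.2⟩
  rintro _ ⟨t, ht, rfl⟩ z hz
  exact (hfar t ht).trans (Metric.infDist_le_dist_of_mem hz)

namespace IsProximinalContracting

variable {C : ℝ} {X : Set Y}

/-- A geodesic whose endpoints have distant projections passes near the first projection. -/
theorem exists_dist_le_left (hX : IsProximinalContracting C X) {γ : ℝ → Y} {a b : ℝ}
    (hab : a ≤ b) (hγ : IsGeodesicOn γ (Icc a b)) {x y : Y} (hx : IsNearestPoint X (γ a) x)
    (hy : IsNearestPoint X (γ b) y) (hxy : C < dist x y) :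
    ∃ t ∈ Icc a b, dist (γ t) x ≤ 2 * C := by
  set K : Set ℝ := {t ∈ Icc a b | Metric.infDist (γ t) X ≤ C} with hK
  have hcont : ContinuousOn (fun t => Metric.infDist (γ t) X) (Icc a b) :=
    (Metric.continuous_infDist_pt X).comp_continuousOn hγ.continuousOn
  have hKc : IsClosed K := hcont.preimage_isClosed_of_isClosed isClosed_Icc isClosed_Iic
  have hKne : K.Nonempty := by
    by_contra hne
    refine absurd (hX.contracting.dist_le_of_geodesic hab hγ (fun t ht => ?_) hx hy) (not_le.2 hxy)
    by_contra hlt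
    exact hne ⟨t, ht, (not_le.1 hlt).le⟩
  have hKbdd : BddBelow K := ⟨a, fun t ht => ht.1.1⟩
  have hmem := hKc.csInf_mem hKne hKbdd
  -- The first time at which the geodesic is within `C` of `X`: before it the contraction property
  -- applies, so the projection has moved by at most `C`.
  set t := sInf K
  have ht0 : t ∈ Icc a b := hmem.1
  rcases ht0.1.eq_or_lt with h | hat
  · have h2 : dist (γ t) x ≤ C := by
      have h3 := hmem.2
      rw [← h] at h3 ⊢
      rwa [hx.2]
    exact ⟨t, ht0, by linarith [hX.nonneg]⟩
  obtain ⟨z, hz⟩ := hX.exists_nearest (γ t)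
  have hsub : Icc a t ⊆ Icc a b := Icc_subset_Icc_right ht0.2
  have hcl : ∀ s ∈ Icc a t, C ≤ Metric.infDist (γ s) X := by
    have hcl : IsClosed {s ∈ Icc a t | C ≤ Metric.infDist (γ s) X} :=
      (hcont.mono hsub).preimage_isClosed_of_isClosed isClosed_Icc isClosed_Ici
    have hIco : Ico a t ⊆ {s ∈ Icc a t | C ≤ Metric.infDist (γ s) X} := by
      intro s hs
      refine ⟨Ico_subset_Icc_self hs, ?_⟩
      by_contra hlt
      exact absurd (csInf_le hKbdd (show s ∈ K from
        ⟨hsub (Ico_subset_Icc_self hs), (not_le.1 hlt).le⟩)) (not_le.2 hs.2)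
    intro s hs
    rw [← closure_Ico hat.ne] at hs
    exact (closure_minimal hIco hcl hs).2
  refine ⟨t, ht0, ?_⟩
  have h1 := hX.contracting.dist_le_of_geodesic ht0.1 (hγ.mono hsub) hcl hx hz
  have h2 : dist (γ t) z ≤ C := hz.2 ▸ hmem.2
  linarith [dist_triangle (γ t) z x, dist_comm x z]

theorem exists_dist_le_right (hX : IsProximinalContracting C X) {γ : ℝ → Y} {a b : ℝ}
    (hab : a ≤ b) (hγ : IsGeodesicOn γ (Icc a b)) {x y : Y} (hx : IsNearestPoint X (γ a) x)
    (hy : IsNearestPoint X (γ b) y) (hxy : C < dist x y) :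
    ∃ t ∈ Icc a b, dist (γ t) y ≤ 2 * C := by
  obtain ⟨t, ht, h⟩ := hX.exists_dist_le_left hab hγ.reverse (x := y) (y := x) (by simpa using hy)
    (by simpa using hx) (by rwa [dist_comm])
  exact ⟨a + b - t, ⟨by linarith [ht.2], by linarith [ht.1]⟩, h⟩

/-- If two points have distant projections, then each projection almost lies between them. -/
theorem dist_add_dist_le (hY : IsGeodesicSpace Y) (hX : IsProximinalContracting C X)
    {p q x y : Y} (hx : IsNearestPoint X p x) (hy : IsNearestPoint X q y) (hxy : C < dist x y) :
    dist p x + dist x q ≤ dist p q + 4 * C := by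
  obtain ⟨γ, hγ, h0, h1⟩ := hY p q
  obtain ⟨t, ht, h⟩ := hX.exists_dist_le_left dist_nonneg hγ (by rwa [h0]) (by rwa [h1]) hxy
  have e1 : dist p (γ t) = t := by
    rw [← h0, hγ 0 ⟨le_rfl, dist_nonneg⟩ t ht, zero_sub, abs_neg, abs_of_nonneg ht.1]
  have e2 : dist (γ t) q = dist p q - t := by
    conv_lhs => rw [← h1]
    rw [hγ t ht _ ⟨dist_nonneg, le_rfl⟩, abs_sub_comm, abs_of_nonneg (by linarith [ht.2])]
  linarith [dist_triangle p (γ t) x, dist_triangle x (γ t) q, dist_comm x (γ t)]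

theorem dist_add_dist_add_dist_le (hY : IsGeodesicSpace Y) (hX : IsProximinalContracting C X)
    {p q x y : Y} (hx : IsNearestPoint X p x) (hy : IsNearestPoint X q y) (hxy : C < dist x y) :
    dist p x + dist x y + dist y q ≤ dist p q + 8 * C := by
  have h1 := hX.dist_add_dist_le hY hx hy hxy
  have h2 := hX.dist_add_dist_le hY hy (isNearestPoint_self hx.1) (by rwa [dist_comm])
  linarith [dist_comm q y, dist_comm q x, dist_comm x y]

/-- A contracting set is quasi-convex. -/
theorem infDist_le_of_between (hY : IsGeodesicSpace Y) (hX : IsProximinalContracting C X)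
    {p q z : Y} {r : ℝ} (hp : Metric.infDist p X ≤ r) (hq : Metric.infDist q X ≤ r)
    (hz : dist p z + dist z q = dist p q) : Metric.infDist z X ≤ 2 * r + 8 * C := by
  obtain ⟨p', hp'⟩ := hX.exists_nearest p
  obtain ⟨q', hq'⟩ := hX.exists_nearest q
  obtain ⟨z', hz'⟩ := hX.exists_nearest z
  have hC := hX.nonneg
  rw [← hp'.2] at hp
  rw [← hq'.2] at hq
  rw [← hz'.2]
  have t1 := dist_triangle p p' q
  have t2 := dist_triangle p' q' q
  have t3 := dist_triangle p' z' q'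
  have t4 := dist_triangle z p p'
  have t5 := dist_triangle z q q'
  have t6 := dist_triangle p z' q'
  have t7 := dist_triangle p q' q
  have t8 := dist_triangle p' z' q
  have s1 := hz'.dist_le hp'.1
  have s2 := hz'.dist_le hq'.1
  have c1 := dist_comm p p'
  have c2 := dist_comm q q'
  have c3 := dist_comm z z'
  have c4 := dist_comm z p
  have c5 := dist_comm p' z'
  have c6 := dist_comm z' p
  have c7 := dist_comm q z
  have n := dist_nonneg (x := p) (y := p')
  -- If `z'` is far from both `p'` and `q'`, the detours from `z` to `X` towards `p` and towards `q`
  -- add up, and cancelling `d(p, q)` leaves `d(z, z') ≤ 8C`. In the other cases `z'` is within `C`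
  -- of `p'` or `q'`, and the triangle inequality suffices.
  by_cases a1 : C < dist z' p'
  · have i1 := hX.dist_add_dist_add_dist_le hY hz' hp' a1
    by_cases a2 : C < dist z' q'
    · have i2 := hX.dist_add_dist_add_dist_le hY hz' hq' a2
      linarith
    · have i3 := hX.dist_add_dist_le hY hz' hp' a1
      linarith [dist_comm z' p, dist_comm q z]
  · by_cases a2 : C < dist z' q'
    · have i3 := hX.dist_add_dist_le hY hz' hq' a2
      linarith
    · linarith [dist_comm q z]

end IsProximinalContracting

/-- All nearest points of `p` in `X` lie in the `κ`-ball around `o`. -/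
def ProjectsNear (X : Set Y) (o : Y) (κ : ℝ) (p : Y) : Prop :=
  ∀ x, IsNearestPoint X p x → dist x o ≤ κ

theorem ProjectsNear.mono {X : Set Y} {o p : Y} {κ κ' : ℝ} (h : ProjectsNear X o κ p)
    (hκ : κ ≤ κ') : ProjectsNear X o κ' p := fun x hx => (h x hx).trans hκ

namespace IsProximinalContracting

variable {C : ℝ} {X : Set Y} {o : Y}

/-- A point far from `o`, between two points that project near `o`, projects near `o`. -/
theorem projectsNear_of_between (hY : IsGeodesicSpace Y) (hX : IsProximinalContracting C X)
    {κ : ℝ} {p q z : Y} (hp : ProjectsNear X o κ p) (hq : ProjectsNear X o κ q)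
    (hz : dist p z + dist z q = dist p q) (hfar : 2 * κ + 4 * C < dist z o) :
    ProjectsNear X o (κ + C) z := by
  intro x hx
  obtain ⟨p', hp'⟩ := hX.exists_nearest p
  obtain ⟨q', hq'⟩ := hX.exists_nearest q
  have h1 := hp p' hp'
  have h2 := hq q' hq'
  by_cases a1 : C < dist p' x
  · by_cases a2 : C < dist q' x
    · have i1 := hX.dist_add_dist_le hY hp' hx a1
      have i2 := hX.dist_add_dist_le hY hq' hx a2
      linarith [dist_triangle p p' o, dist_triangle q q' o, dist_triangle o p' z,
        dist_triangle o q' z, dist_triangle p o q, dist_comm o p', dist_comm o q',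
        dist_comm z o, dist_comm q o, dist_comm z q]
    · linarith [dist_triangle x q' o, dist_comm x q']
  · linarith [dist_triangle x p' o, dist_comm x p']

/-- If `x` projects near `o` and is far from `o`, and `x` is almost as close to `p` as `o` is,
then `p` projects near `o`. -/
theorem projectsNear_of_dist_le (hY : IsGeodesicSpace Y) (hX : IsProximinalContracting C X)
    {κ M : ℝ} {p x : Y} (hx : ProjectsNear X o κ x) (hpx : dist p x ≤ dist p o + M)
    (hfar : M + 2 * κ + 4 * C < dist x o) : ProjectsNear X o (κ + C) p := by
  intro y hy
  obtain ⟨x', hx'⟩ := hX.exists_nearest x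
  have h1 := hx x' hx'
  by_cases a1 : C < dist x' y
  · have i1 := hX.dist_add_dist_le hY hx' hy a1
    linarith [dist_triangle x x' o, dist_triangle o x' p, dist_comm o x', dist_comm p x,
      dist_comm p o]
  · linarith [dist_triangle y x' o, dist_comm y x']

end IsProximinalContracting
end Geometry

/-! ### Equivariance of projections under isometries -/

section Action

variable {G Y : Type*} [Group G] [MetricSpace Y] [MulAction G Y] [IsIsometricSMul G Y]
open scoped Pointwise

theorem IsNearestPoint.smul {X : Set Y} {p x : Y} (h : IsNearestPoint X p x) (g : G) :
    IsNearestPoint (g • X) (g • p) (g • x) := by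
  refine isNearestPoint_iff.2 ⟨smul_mem_smul_set h.1, ?_⟩
  rintro _ ⟨y, hy, rfl⟩
  simpa using h.dist_le hy

theorem isNearestPoint_smul_iff {X : Set Y} {p x : Y} (g : G) :
    IsNearestPoint (g • X) (g • p) (g • x) ↔ IsNearestPoint X p x :=
  ⟨fun h => by simpa using h.smul g⁻¹, fun h => h.smul g⟩

theorem isNearestPoint_smul_set_iff {X : Set Y} {p x : Y} (g : G) :
    IsNearestPoint (g • X) p x ↔ IsNearestPoint X (g⁻¹ • p) (g⁻¹ • x) := by
  rw [← isNearestPoint_smul_iff (X := X) g]; simp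

theorem infDist_smul_set (X : Set Y) (p : Y) (g : G) :
    Metric.infDist (g • p) (g • X) = Metric.infDist p X :=
  Metric.infDist_image (isometry_smul Y g)

theorem IsGeodesicOn.smul {γ : ℝ → Y} {I : Set ℝ} (h : IsGeodesicOn γ I) (g : G) :
    IsGeodesicOn (fun t => g • γ t) I := fun s hs t ht => by simpa using h s hs t ht

theorem IsProximinalContracting.smul {C : ℝ} {X : Set Y} (h : IsProximinalContracting C X)
    (g : G) : IsProximinalContracting C (g • X) := by
  refine ⟨h.nonneg, ?_, fun p => ?_⟩
  · rintro γ I hI hγ hfar x ⟨hx, p, ⟨s, hs, rfl⟩, hpx⟩ y ⟨hy, q, ⟨t, ht, rfl⟩, hqy⟩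
    have h1 := (isNearestPoint_smul_set_iff (X := X) g).1 ⟨hx, hpx⟩
    have h2 := (isNearestPoint_smul_set_iff (X := X) g).1 ⟨hy, hqy⟩
    have := h.contracting (fun t => g⁻¹ • γ t) I hI (hγ.smul g⁻¹) ?_ (g⁻¹ • x)
      ⟨h1.1, _, ⟨s, hs, rfl⟩, h1.2⟩ (g⁻¹ • y) ⟨h2.1, _, ⟨t, ht, rfl⟩, h2.2⟩
    · simpa using this
    · rintro _ ⟨r, hr, rfl⟩ z hz
      have := hfar _ ⟨r, hr, rfl⟩ (g • z) (smul_mem_smul_set hz)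
      rwa [← dist_smul g, smul_inv_smul]
  · obtain ⟨x, hx⟩ := h.exists_nearest (g⁻¹ • p)
    exact ⟨g • x, by simpa using hx.smul g⟩

end Action

/-! ### Ping-pong with projections to a contracting axis -/

section PingPong

variable {G Y : Type*} [Group G] [MetricSpace Y] [MulAction G Y]

open scoped Pointwise

/-- The product `a₁ f a₂ f ⋯ aₖ f`. -/
def altProd (f : G) (l : List G) : G := (l.map (· * f)).prod

@[simp] theorem altProd_nil (f : G) : altProd f [] = 1 := rfl

@[simp] theorem altProd_cons (f a : G) (l : List G) :
    altProd f (a :: l) = a * f * altProd f l := by simp [altProd]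

@[simp] theorem altProd_append (f : G) (l l' : List G) :
    altProd f (l ++ l') = altProd f l * altProd f l' := by simp [altProd]

/-- The element `f` translates the contracting set `X` passing near `o` by a large distance, and
the elements of `A` lie in an annulus of inner radius `ℓ`, have a separated orbit, and move `o`
transversally to `X`. -/
structure IsPingPong (o : Y) (C τ ℓ : ℝ) (X : Set Y) (f : G) (A : Set G) : Prop where
  contracting : IsProximinalContracting C X
  smul_set : f • X = X
  near_base : ProjectsNear X o τ o
  near : ∀ a ∈ A, ProjectsNear X o τ (a • o)
  near_inv : ∀ a ∈ A, ProjectsNear X o τ (a⁻¹ • o)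
  long : 2 * τ + 7 * C < dist o (f • o)
  large : 2 * τ + 6 * C < ℓ
  le_dist : ∀ a ∈ A, ℓ ≤ dist o (a • o)
  dist_le : ∀ a ∈ A, dist o (a • o) ≤ ℓ + 1
  separated : ∀ a ∈ A, ∀ b ∈ A, a ≠ b → 8 * C + 4 * τ + 1 < dist (a • o) (b • o)

namespace IsPingPong

variable {o : Y} {C τ ℓ : ℝ} {X : Set Y} {f : G} {A : Set G}

theorem nonneg (h : IsPingPong o C τ ℓ X f A) : 0 ≤ τ := by
  obtain ⟨x, hx⟩ := h.contracting.exists_nearest o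
  exact dist_nonneg.trans (h.near_base x hx)

variable [IsIsometricSMul G Y]

theorem isNearestPoint_inv_smul (h : IsPingPong o C τ ℓ X f A) {q y : Y}
    (hy : IsNearestPoint X q y) : IsNearestPoint X (f⁻¹ • q) (f⁻¹ • y) := by
  rw [← h.smul_set] at hy
  exact (isNearestPoint_smul_set_iff f).1 hy

theorem dist_smul_le (h : IsPingPong o C τ ℓ X f A) {κ : ℝ} {q y : Y}
    (hq : ProjectsNear X o κ (f⁻¹ • q)) (hy : IsNearestPoint X q y) : dist y (f • o) ≤ κ := by
  have := hq _ (h.isNearestPoint_inv_smul hy)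
  rwa [← dist_smul f, smul_inv_smul] at this

theorem lt_dist_nearest (h : IsPingPong o C τ ℓ X f A) {κ : ℝ} {p q x y : Y}
    (hκ : 2 * κ + C < dist o (f • o)) (hp : ProjectsNear X o κ p)
    (hq : ProjectsNear X o κ (f⁻¹ • q)) (hx : IsNearestPoint X p x)
    (hy : IsNearestPoint X q y) : C < dist x y := by
  linarith [hp x hx, h.dist_smul_le hq hy, dist_triangle o x (f • o), dist_triangle x y (f • o),
    dist_comm o x]

/-- Otherwise a projection of `p` would be close to both `o` and `f • o`. -/
theorem not_projectsNear_and (h : IsPingPong o C τ ℓ X f A) {p : Y}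
    (h1 : ProjectsNear X o (τ + C) p) (h2 : ProjectsNear X o (τ + C) (f⁻¹ • p)) : False := by
  have hC := h.contracting.nonneg
  obtain ⟨x, hx⟩ := h.contracting.exists_nearest p
  have := h.lt_dist_nearest (by linarith [h.long]) h1 h2 hx hx
  rw [dist_self] at this
  linarith

/-- If `p` projects far from `o` on `X`, geodesics from `a • o` to `p` pass near `o`; if `p`
projects far from `a • o` on `a • X`, geodesics from `o` to `p` pass near `a • o`. Adding the two
estimates bounds `d(o, a o)` by `2τ + 4C`, against `large`. -/
theorem projectsNear_or (hY : IsGeodesicSpace Y) (h : IsPingPong o C τ ℓ X f A) {a : G}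
    (ha : a ∈ A) (p : Y) :
    ProjectsNear X o (τ + C) p ∨ ProjectsNear X o (τ + C) (a⁻¹ • p) := by
  by_contra! hcon
  simp only [ProjectsNear, not_forall, not_le] at hcon
  obtain ⟨⟨x, hx, hxo⟩, y, hy, hyo⟩ := hcon
  have hX := h.contracting
  obtain ⟨u, hu⟩ := hX.exists_nearest (a • o)
  obtain ⟨v, hv⟩ := hX.exists_nearest (a⁻¹ • o)
  have h1 := h.near a ha u hu
  have h2 := h.near_inv a ha v hv
  have i1 := hX.dist_add_dist_le hY hu hx (by linarith [dist_triangle x u o, dist_comm u x])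
  have i2 := hX.dist_add_dist_le hY hv hy (by linarith [dist_triangle y v o, dist_comm v y])
  have e1 : dist (a⁻¹ • o) (a⁻¹ • p) = dist o p := dist_smul _ _ _
  have e2 : dist (a⁻¹ • o) o = dist o (a • o) := by rw [← dist_smul a, smul_inv_smul]
  have e3 : dist o (a⁻¹ • p) = dist (a • o) p := by rw [← dist_smul a, smul_inv_smul]
  linarith [dist_triangle (a • o) u o, dist_triangle o u p, dist_triangle (a⁻¹ • o) v o,
    dist_triangle o v (a⁻¹ • p), dist_comm o u, dist_comm o v, dist_comm o (a • o), h.large,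
    h.le_dist a ha, hX.nonneg]

theorem exists_dist_le_of_not_projectsNear (h : IsPingPong o C τ ℓ X f A) {a : G}
    (ha : a ∈ A) {p : Y} {γ : ℝ → Y} (hγ : IsGeodesicSegment γ o p)
    (hp : ¬ ProjectsNear X o (τ + C) (a⁻¹ • p)) :
    ∃ t ∈ Icc 0 (dist o p), dist (γ t) (a • o) ≤ 2 * C + τ := by
  simp only [ProjectsNear, not_forall, not_le] at hp
  obtain ⟨y, hy, hyo⟩ := hp
  have hX := h.contracting
  obtain ⟨v, hv⟩ := hX.exists_nearest (a⁻¹ • o)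
  have h2 := h.near_inv a ha v hv
  obtain ⟨t, ht, hd⟩ := hX.exists_dist_le_left (γ := fun t => a⁻¹ • γ t) dist_nonneg
    (hγ.1.smul a⁻¹) (x := v) (y := y) (by rwa [hγ.2.1]) (by rwa [hγ.2.2])
    (by linarith [dist_triangle y v o, dist_comm v y])
  refine ⟨t, ht, ?_⟩
  rw [← dist_smul a⁻¹, inv_smul_smul]
  linarith [dist_triangle (a⁻¹ • γ t) v o]

/-- Otherwise one geodesic `[o, p]` passes within `2C + τ` of both `a • o` and `b • o`. As these lie
in an annulus of width `1`, the two passing times differ by at most `2(2C + τ) + 1`, so the points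
are closer than `separated` allows. -/
theorem projectsNear_inv_or (hY : IsGeodesicSpace Y) (h : IsPingPong o C τ ℓ X f A) {a b : G}
    (ha : a ∈ A) (hb : b ∈ A) (hab : a ≠ b) (p : Y) :
    ProjectsNear X o (τ + C) (a⁻¹ • p) ∨ ProjectsNear X o (τ + C) (b⁻¹ • p) := by
  by_contra! hcon
  obtain ⟨γ, hγ⟩ := hY o p
  obtain ⟨s, hs, hsa⟩ := h.exists_dist_le_of_not_projectsNear ha hγ hcon.1
  obtain ⟨t, ht, htb⟩ := h.exists_dist_le_of_not_projectsNear hb hγ hcon.2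
  have e1 := hγ.1 0 ⟨le_rfl, dist_nonneg⟩ s hs
  have e2 := hγ.1 0 ⟨le_rfl, dist_nonneg⟩ t ht
  have e3 := hγ.1 s hs t ht
  rw [hγ.2.1, zero_sub, abs_neg, abs_of_nonneg hs.1] at e1
  rw [hγ.2.1, zero_sub, abs_neg, abs_of_nonneg ht.1] at e2
  have hst : |s - t| ≤ 2 * (2 * C + τ) + 1 := by
    have := h.le_dist a ha
    have := h.le_dist b hb
    have := h.dist_le a ha
    have := h.dist_le b hb
    rw [abs_le]
    constructor <;> linarith [dist_triangle o (γ s) (a • o), dist_triangle o (a • o) (γ s),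
      dist_triangle o (γ t) (b • o), dist_triangle o (b • o) (γ t), dist_comm (γ s) (a • o),
      dist_comm (γ t) (b • o)]
  linarith [h.separated a ha b hb hab, dist_triangle (a • o) (γ s) (b • o),
    dist_triangle (γ s) (γ t) (b • o), dist_comm (a • o) (γ s)]

/-- Induction on the word: by `projectsNear_or` a failure for `a f w` would make `f w o` project
near `o`; but `w o` does so too, and a point and its image under `f` cannot both. -/
theorem projectsNear_smul (hY : IsGeodesicSpace Y) (h : IsPingPong o C τ ℓ X f A) {l : List G}
    (hl : ∀ a ∈ l, a ∈ A) : ProjectsNear X o (τ + C) (altProd f l • o) := by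
  induction l with
  | nil => simpa using h.near_base.mono (by linarith [h.contracting.nonneg])
  | cons a l ih =>
    refine (h.projectsNear_or hY (hl a (by simp)) _).resolve_right fun hN => ?_
    refine h.not_projectsNear_and hN ?_
    simpa [mul_smul] using ih fun b hb => hl b (by simp [hb])

theorem not_projectsNear_inv_smul (hY : IsGeodesicSpace Y) (h : IsPingPong o C τ ℓ X f A)
    {a : G} {l : List G} (hl : ∀ b ∈ a :: l, b ∈ A) :
    ¬ ProjectsNear X o (τ + C) (a⁻¹ • altProd f (a :: l) • o) := fun hN => by
  refine h.not_projectsNear_and hN ?_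
  simpa [mul_smul] using h.projectsNear_smul hY (l := l) fun b hb => hl b (by simp [hb])

/-- The mirror image of `projectsNear_smul`, for looking back along a word. The last letter of the
word takes the role of `a` in the induction hypothesis, whence the generalization over `a`. -/
theorem projectsNear_inv_smul_inv_smul (hY : IsGeodesicSpace Y) (h : IsPingPong o C τ ℓ X f A)
    {l : List G} (hl : ∀ b ∈ l, b ∈ A) {a : G} (ha : a ∈ A) :
    ProjectsNear X o (τ + C) (a⁻¹ • (altProd f l)⁻¹ • o) := by
  induction l using List.reverseRecOn generalizing a with
  | nil => simpa using (h.near_inv a ha).mono (by linarith [h.contracting.nonneg])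
  | append_singleton l b ih =>
    refine (h.projectsNear_or hY ha _).resolve_left fun hN => ?_
    refine h.not_projectsNear_and (p := f • (altProd f (l ++ [b]))⁻¹ • o) ?_ (by simpa using hN)
    simpa [mul_smul] using ih (fun c hc => hl c (by simp [hc])) (hl b (by simp))

/-- The first letter of a word can be read off from the point to which it moves `o`. -/
theorem projectsNear_inv_smul_of_head_ne (hY : IsGeodesicSpace Y)
    (h : IsPingPong o C τ ℓ X f A) {a : G} (ha : a ∈ A) {l : List G} (hl : ∀ b ∈ l, b ∈ A)
    (hne : l.head? ≠ some a) : ProjectsNear X o (τ + C) (a⁻¹ • altProd f l • o) := by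
  cases l with
  | nil => simpa using (h.near_inv a ha).mono (by linarith [h.contracting.nonneg])
  | cons b l =>
    refine (h.projectsNear_inv_or hY ha (hl b (by simp)) ?_ _).resolve_right
      (h.not_projectsNear_inv_smul hY hl)
    rintro rfl
    simp at hne

theorem altProd_injOn (hY : IsGeodesicSpace Y) (h : IsPingPong o C τ ℓ X f A) :
    ∀ {l l' : List G}, (∀ b ∈ l, b ∈ A) → (∀ b ∈ l', b ∈ A) → altProd f l = altProd f l' →
      l = l' := by
  intro l
  induction l with
  | nil =>
    intro l' _ hl' he
    cases l' with
    | nil => rfl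
    | cons b l' =>
      refine absurd ?_ (h.not_projectsNear_inv_smul hY hl')
      rw [← he]
      exact h.projectsNear_inv_smul_of_head_ne hY (hl' b (by simp)) (by simp) (by simp)
  | cons a l ih =>
    intro l' hl hl' he
    have hhead : l'.head? = some a := by
      by_contra hne
      refine absurd ?_ (h.not_projectsNear_inv_smul hY hl)
      rw [he]
      exact h.projectsNear_inv_smul_of_head_ne hY (hl a (by simp)) hl' hne
    cases l' with
    | nil => simp at hhead
    | cons b l' =>
      obtain rfl : b = a := by simpa using hhead
      rw [ih (fun c hc => hl c (List.mem_cons_of_mem _ hc))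
      (fun c hc => hl' c (List.mem_cons_of_mem _ hc)) (by simpa using he)]

/-- The projections of `p` and `q` are near `o` and `f • o`, hence more than `C` apart. The error is
`4C` from `dist_add_dist_le` plus twice the radius `τ + C`. -/
theorem dist_base_smul_le (hY : IsGeodesicSpace Y) (h : IsPingPong o C τ ℓ X f A) {p q : Y}
    (hp : ProjectsNear X o (τ + C) p) (hq : ProjectsNear X o (τ + C) (f⁻¹ • q)) :
    dist p o + dist o q ≤ dist p q + (2 * τ + 6 * C) := by
  have hX := h.contracting
  obtain ⟨x, hx⟩ := hX.exists_nearest p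
  obtain ⟨y, hy⟩ := hX.exists_nearest q
  have := hX.dist_add_dist_le hY hx hy
    (h.lt_dist_nearest (by linarith [h.long, hX.nonneg]) hp hq hx hy)
  linarith [hp x hx, dist_triangle p x o, dist_triangle o x q, dist_comm o x]

theorem dist_smul_base_le (hY : IsGeodesicSpace Y) (h : IsPingPong o C τ ℓ X f A) {p q : Y}
    (hp : ProjectsNear X o (τ + C) p) (hq : ProjectsNear X o (τ + C) (f⁻¹ • q)) :
    dist p (f • o) + dist (f • o) q ≤ dist p q + (2 * τ + 6 * C) := by
  have hX := h.contracting
  obtain ⟨x, hx⟩ := hX.exists_nearest p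
  obtain ⟨y, hy⟩ := hX.exists_nearest q
  have := hX.dist_add_dist_le hY hy hx (by
    rw [dist_comm]; exact h.lt_dist_nearest (by linarith [h.long, hX.nonneg]) hp hq hx hy)
  linarith [h.dist_smul_le hq hy, dist_triangle q y (f • o), dist_triangle (f • o) y p,
    dist_comm (f • o) y, dist_comm p (f • o), dist_comm q (f • o), dist_comm p q]

/-- The path from `a⁻¹ o` to `f w o` nearly passes through `o` and then `f o`. Each passage costs
`2τ + 6C`, but the length of `f` pays for the second. That the loss per letter is independent of `ℓ`
is essential for the upper bound on the critical exponent. -/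
theorem le_dist_altProd_cons (hY : IsGeodesicSpace Y) (h : IsPingPong o C τ ℓ X f A) {a : G}
    {l : List G} (hl : ∀ b ∈ a :: l, b ∈ A) :
    dist o (altProd f l • o) + (ℓ - (2 * τ + 6 * C)) ≤ dist o (altProd f (a :: l) • o) := by
  have ha : a ∈ A := hl a (by simp)
  have hC := h.contracting.nonneg
  have hq : ProjectsNear X o (τ + C) (f⁻¹ • f • altProd f l • o) := by
    rw [inv_smul_smul]; exact h.projectsNear_smul hY fun b hb => hl b (by simp [hb])
  have i1 := h.dist_base_smul_le hY (p := a⁻¹ • o)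
    ((h.near_inv a ha).mono (by linarith)) hq
  have i2 := h.dist_smul_base_le hY (p := o) (h.near_base.mono (by linarith)) hq
  have e1 : dist (a⁻¹ • o) o = dist o (a • o) := by rw [← dist_smul a, smul_inv_smul]
  have e2 : dist (a⁻¹ • o) (f • altProd f l • o) = dist o (altProd f (a :: l) • o) := by
    rw [← dist_smul a, smul_inv_smul, altProd_cons, mul_smul, mul_smul]
  rw [dist_smul] at i2
  linarith [h.long, h.le_dist a ha, h.nonneg]

theorem le_dist_altProd (hY : IsGeodesicSpace Y) (h : IsPingPong o C τ ℓ X f A) {l : List G}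
    (hl : ∀ b ∈ l, b ∈ A) : l.length * (ℓ - (2 * τ + 6 * C)) ≤ dist o (altProd f l • o) := by
  induction l with
  | nil => simp
  | cons a l ih =>
    have h1 := ih fun b hb => hl b (by simp [hb])
    have h2 := h.le_dist_altProd_cons hY hl
    push_cast [List.length_cons]
    linarith

theorem dist_altProd_le (h : IsPingPong o C τ ℓ X f A) {l : List G}
    (hl : ∀ b ∈ l, b ∈ A) :
    dist o (altProd f l • o) ≤ l.length * (ℓ + 1 + dist o (f • o)) := by
  induction l with
  | nil => simp
  | cons a l ih =>
    have h1 := ih fun b hb => hl b (by simp [hb])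
    have h2 := h.dist_le a (hl a (by simp))
    have h3 := dist_triangle o (a • o) (altProd f (a :: l) • o)
    rw [altProd_cons, mul_smul, mul_smul, dist_smul] at h3
    have h4 := dist_triangle o (f • o) (f • altProd f l • o)
    rw [dist_smul] at h4
    rw [altProd_cons, mul_smul, mul_smul]
    push_cast [List.length_cons]
    linarith

/-- Words with different first letters move `o` in almost opposite directions. -/
theorem dist_add_dist_le_of_head_ne (hY : IsGeodesicSpace Y) (h : IsPingPong o C τ ℓ X f A)
    {a : G} {l l' : List G} (hl : ∀ b ∈ a :: l, b ∈ A) (hl' : ∀ b ∈ l', b ∈ A)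
    (hne : l'.head? ≠ some a) :
    dist o (altProd f (a :: l) • o) + dist o (altProd f l' • o) ≤
      dist (altProd f (a :: l) • o) (altProd f l' • o) + (2 * (ℓ + 1) + (2 * τ + 6 * C)) := by
  have ha : a ∈ A := hl a (by simp)
  have i1 := h.dist_base_smul_le hY (h.projectsNear_inv_smul_of_head_ne hY ha hl' hne)
    (q := a⁻¹ • altProd f (a :: l) • o) (by
      simpa [mul_smul] using h.projectsNear_smul hY (l := l) fun b hb => hl b (by simp [hb]))
  have e1 : dist (a⁻¹ • altProd f l' • o) o = dist (altProd f l' • o) (a • o) := by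
    rw [← dist_smul a, smul_inv_smul]
  have e2 : dist o (a⁻¹ • altProd f (a :: l) • o) = dist (a • o) (altProd f (a :: l) • o) := by
    rw [← dist_smul a, smul_inv_smul]
  rw [dist_smul, e1, e2] at i1
  have := h.dist_le a ha
  linarith [dist_triangle o (a • o) (altProd f (a :: l) • o),
    dist_triangle o (a • o) (altProd f l' • o), dist_comm (a • o) (altProd f l' • o),
    dist_comm (altProd f (a :: l) • o) (altProd f l' • o)]

end IsPingPong
end PingPong

/-! ### The free semigroup and its Cayley graph -/

section Semigroup

variable {G Y : Type*} [Group G] [MetricSpace Y] [MulAction G Y]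

/-- The set `{a f : a ∈ A}`. -/
def altGenerators (f : G) (A : Set G) : Set G := (fun a => a * f) '' A

theorem mul_mem_altGenerators {f a : G} {A : Set G} (ha : a ∈ A) : a * f ∈ altGenerators f A :=
  mem_image_of_mem _ ha

theorem mem_closure_altGenerators {f : G} {A : Set G} {g : G} :
    g ∈ Subsemigroup.closure (altGenerators f A) ↔
      ∃ l : List G, l ≠ [] ∧ (∀ a ∈ l, a ∈ A) ∧ altProd f l = g := by
  constructor
  · intro hg
    induction hg using Subsemigroup.closure_induction with
    | mem x hx =>
      obtain ⟨a, ha, rfl⟩ := hx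
      exact ⟨[a], by simp, by simpa using ha, by simp⟩
    | mul x y _ _ hx hy =>
      obtain ⟨l, hl, hlA, rfl⟩ := hx
      obtain ⟨m, -, hmA, rfl⟩ := hy
      refine ⟨l ++ m, by simp [hl], fun a ha => ?_, by simp⟩
      exact (List.mem_append.1 ha).elim (hlA a) (hmA a)
  · rintro ⟨l, hl, hlA, rfl⟩
    induction l with
    | nil => exact absurd rfl hl
    | cons a l ih =>
      have ha := Subsemigroup.subset_closure (mul_mem_altGenerators (f := f) (hlA a (by simp)))
      rcases eq_or_ne l [] with rfl | hne
      · simpa using ha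
      · rw [altProd_cons]
        exact mul_mem ha (ih hne fun b hb => hlA b (by simp [hb]))

theorem eq_one_or_mem_closure_altGenerators {f : G} {A : Set G} {g : G} :
    (g = 1 ∨ g ∈ Subsemigroup.closure (altGenerators f A)) ↔
      ∃ l : List G, (∀ a ∈ l, a ∈ A) ∧ altProd f l = g := by
  rw [mem_closure_altGenerators]
  constructor
  · rintro (rfl | ⟨l, -, hl⟩)
    · exact ⟨[], by simp, rfl⟩
    · exact ⟨l, hl⟩
  · rintro ⟨l, hl, hg⟩
    rcases eq_or_ne l [] with rfl | hne
    · exact Or.inl hg.symm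
    · exact Or.inr ⟨l, hne, hl, hg⟩

theorem freeSemigroup_lift_eq_prod {S : Set G} (x : FreeSemigroup S) :
    FreeSemigroup.lift (fun s : S => (s : G)) x = ((x.head :: x.tail).map (↑)).prod := by
  induction x using FreeSemigroup.recOnMul with
  | ih1 x => simp
  | ih2 x y hx hy => simp [map_mul, hy]

theorem List.exists_common_prefix {α : Type*} : ∀ l m : List α, ∃ c r s : List α,
    l = c ++ r ∧ m = c ++ s ∧ ∀ a, r.head? = some a → s.head? ≠ some a
  | [], m => ⟨[], [], m, rfl, rfl, by simp⟩
  | a :: l, [] => ⟨[], a :: l, [], rfl, rfl, by simp⟩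
  | a :: l, b :: m => by
    by_cases hab : a = b
    · obtain ⟨c, r, s, h1, h2, h3⟩ := List.exists_common_prefix l m
      exact ⟨a :: c, r, s, by simp [h1], by simp [h2, hab], h3⟩
    · exact ⟨[], a :: l, b :: m, rfl, rfl, by simpa using Ne.symm hab⟩

/-- The vertices of the Cayley graph of the semigroup generated by the elements `a f`. -/
abbrev AltVertex (f : G) (A : Set G) : Type _ :=
  {g : G // g = 1 ∨ g ∈ Subsemigroup.closure (altGenerators f A)}

/-- The Cayley graph of the semigroup generated by the elements `a f`. -/
abbrev altCayleyGraph (f : G) (A : Set G) :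
    SimpleGraph (AltVertex f A) :=
  semigroupCayleyGraph (Subsemigroup.closure (altGenerators f A)) (altGenerators f A)

namespace IsPingPong

variable [IsIsometricSMul G Y] {o : Y} {C τ ℓ : ℝ} {X : Set Y} {f : G} {A : Set G}

theorem isFreeSemigroupOn (hY : IsGeodesicSpace Y) (h : IsPingPong o C τ ℓ X f A)
    (hA : A.Nonempty) :
    IsFreeSemigroupOn (Subsemigroup.closure (altGenerators f A)) (altGenerators f A) := by
  refine ⟨hA.image _, rfl, fun x y hxy => ?_⟩
  rw [freeSemigroup_lift_eq_prod, freeSemigroup_lift_eq_prod] at hxy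
  -- Stripping `f` turns words in the generators into words in `A`, to which `altProd_injOn`
  -- applies.
  set φ : altGenerators f A → G := fun s => s * f⁻¹
  have hφ : Function.Injective φ := fun s t hst => Subtype.ext (mul_right_cancel hst)
  have hmem : ∀ l : List (altGenerators f A), ∀ a ∈ l.map φ, a ∈ A := by
    intro l a ha
    obtain ⟨⟨s, b, hb, rfl⟩, -, rfl⟩ := List.mem_map.1 ha
    simpa [φ] using hb
  have hprod : ∀ l : List (altGenerators f A), altProd f (l.map φ) = (l.map (↑)).prod := by
    intro l
    simp [altProd, φ, Function.comp_def]
  rw [← hprod, ← hprod] at hxy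
  have := List.map_injective_iff.2 hφ (h.altProd_injOn hY (hmem _) (hmem _) hxy)
  exact FreeSemigroup.ext (List.cons.inj this).1 (List.cons.inj this).2

theorem altProd_ne_self (hY : IsGeodesicSpace Y) (h : IsPingPong o C τ ℓ X f A) {l : List G}
    (hl : ∀ a ∈ l, a ∈ A) (hne : l ≠ []) : altProd f l ≠ 1 := fun he =>
  hne (h.altProd_injOn hY hl (by simp) (he.trans (altProd_nil f).symm))

theorem altCayleyGraph_adj_iff (hY : IsGeodesicSpace Y) (h : IsPingPong o C τ ℓ X f A)
    {u v : AltVertex f A} :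
    (altCayleyGraph f A).Adj u v ↔
      (∃ a ∈ A, (v : G) = u * (a * f)) ∨ ∃ a ∈ A, (u : G) = v * (a * f) := by
  have key : ∀ a ∈ A, a * f ≠ 1 := fun a ha => by
    simpa using h.altProd_ne_self hY (l := [a]) (by simpa using ha) (by simp)
  have hmem : ∀ g g' : G, (∃ s ∈ altGenerators f A, g' = g * s) ↔ ∃ a ∈ A, g' = g * (a * f) :=
    fun g g' => exists_mem_image
  unfold altCayleyGraph semigroupCayleyGraph
  rw [SimpleGraph.fromRel_adj, hmem, hmem, and_iff_right_iff_imp]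
  rintro (⟨a, ha, he⟩ | ⟨a, ha, he⟩) rfl
  · exact key a ha (by simpa using he)
  · exact key a ha (by simpa using he)

theorem exists_walk (hY : IsGeodesicSpace Y) (h : IsPingPong o C τ ℓ X f A) {l : List G}
    (hl : ∀ a ∈ l, a ∈ A)
    (u v : AltVertex f A)
    (huv : (v : G) = u * altProd f l) :
    ∃ w : (altCayleyGraph f A).Walk u v, w.length = l.length := by
  induction l generalizing u with
  | nil =>
    obtain rfl : v = u := Subtype.ext (by simpa using huv)
    exact ⟨.nil, rfl⟩
  | cons a l ih =>
    have ha : a ∈ A := hl a (by simp)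
    obtain ⟨m, hm, hmu⟩ := eq_one_or_mem_closure_altGenerators.1 u.2
    have hu' : (u : G) * (a * f) = 1 ∨
        (u : G) * (a * f) ∈ Subsemigroup.closure (altGenerators f A) := by
      refine eq_one_or_mem_closure_altGenerators.2 ⟨m ++ [a], fun b hb => ?_, by simp [hmu]⟩
      rcases List.mem_append.1 hb with hb | hb
      · exact hm b hb
      · rwa [List.mem_singleton.1 hb]
    obtain ⟨w, hw⟩ := ih (fun b hb => hl b (by simp [hb])) ⟨_, hu'⟩ (by simp [huv, mul_assoc])
    exact ⟨.cons ((h.altCayleyGraph_adj_iff hY).2 (Or.inl ⟨a, ha, rfl⟩)) w, by simp [hw]⟩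

theorem connected_altCayleyGraph (hY : IsGeodesicSpace Y) (h : IsPingPong o C τ ℓ X f A) :
    (altCayleyGraph f A).Connected := by
  have h1 : ∀ v, (altCayleyGraph f A).Reachable ⟨1, Or.inl rfl⟩ v := fun v => by
    obtain ⟨m, hm, hmv⟩ := eq_one_or_mem_closure_altGenerators.1 v.2
    obtain ⟨w, -⟩ := h.exists_walk hY hm ⟨1, Or.inl rfl⟩ v (by simp [hmv])
    exact ⟨w⟩
  exact { preconnected := fun u v => (h1 u).symm.trans (h1 v), nonempty := ⟨⟨1, Or.inl rfl⟩⟩ }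

/-- The set `D` of descendants of `v` can be entered or left only through the edge from its parent
`u`, because by freeness a vertex has a unique word and so a unique parent. And `u` is not in `D`,
as no non-empty word is trivial. -/
theorem not_reachable_deleteEdges (hY : IsGeodesicSpace Y) (h : IsPingPong o C τ ℓ X f A)
    {u v : AltVertex f A} {b : G}
    (hb : b ∈ A) (huv : (v : G) = u * (b * f)) :
    ¬ ((altCayleyGraph f A).deleteEdges {s(u, v)}).Reachable u v := by
  rintro ⟨w⟩
  obtain ⟨lu, hlu, hu⟩ := eq_one_or_mem_closure_altGenerators.1 u.2
  have hmem : ∀ {l m : List G}, (∀ a ∈ l, a ∈ A) → (∀ a ∈ m, a ∈ A) → ∀ a ∈ l ++ m, a ∈ A :=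
    fun hl hm a ha => (List.mem_append.1 ha).elim (hl a) (hm a)
  have hsing : ∀ {a : G}, a ∈ A → ∀ c ∈ [a], c ∈ A := fun ha c hc => by
    rwa [List.mem_singleton.1 hc]
  let D : AltVertex f A → Prop := fun x =>
    ∃ l : List G, (∀ a ∈ l, a ∈ A) ∧ (x : G) = v * altProd f l
  have hstep : ∀ x y : AltVertex f A, ∀ a ∈ A, (y : G) = x * (a * f) → s(x, y) ≠ s(u, v) → (D x ↔ D y) := by
    intro x y a ha hxy hne
    constructor
    · rintro ⟨l, hl, hx⟩
      exact ⟨l ++ [a], hmem hl (hsing ha), by simp [hxy, hx, mul_assoc]⟩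
    · rintro ⟨l, hl, hy⟩
      obtain ⟨lx, hlx, hx⟩ := eq_one_or_mem_closure_altGenerators.1 x.2
      have he : altProd f (lx ++ [a]) = altProd f (lu ++ [b] ++ l) := by
        simp only [altProd_append, altProd_cons, altProd_nil, mul_one, hx, hu]
        rw [← hxy, hy, huv]
      have he := h.altProd_injOn hY (hmem hlx (hsing ha)) (hmem (hmem hlu (hsing hb)) hl) he
      rcases l.eq_nil_or_concat with rfl | ⟨l', c, rfl⟩
      · rw [List.append_nil] at he
        obtain ⟨h1, h2⟩ := List.append_inj' he rfl
        obtain rfl : x = u := Subtype.ext (by rw [← hx, ← hu, h1])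
        obtain rfl : y = v := Subtype.ext (by rw [hxy, huv, (List.cons.inj h2).1])
        exact absurd rfl hne
      · rw [List.concat_eq_append, ← List.append_assoc] at he
        obtain ⟨h1, -⟩ := List.append_inj' he rfl
        exact ⟨l', fun c hc => hl c (by simp [hc]), by simp [← hx, h1, hu, huv, mul_assoc]⟩
  have hwalk : ∀ x y, ((altCayleyGraph f A).deleteEdges {s(u, v)}).Walk x y → (D x ↔ D y) := by
    intro x y p
    induction p with
    | nil => rfl
    | cons hadj p ih =>
      rw [← ih]
      rw [SimpleGraph.deleteEdges_adj, h.altCayleyGraph_adj_iff hY] at hadj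
      obtain ⟨⟨a, ha, he⟩ | ⟨a, ha, he⟩, hne⟩ := hadj
      · exact hstep _ _ a ha he hne
      · exact (hstep _ _ a ha he (by rwa [Sym2.eq_swap])).symm
  obtain ⟨l, hl, he⟩ := (hwalk u v w).2 ⟨[], by simp, by simp⟩
  refine h.altProd_ne_self hY (l := b :: l) (by simpa using ⟨hb, hl⟩) (by simp) ?_
  rw [huv, mul_assoc] at he
  simpa using he.symm

theorem isTree_altCayleyGraph (hY : IsGeodesicSpace Y) (h : IsPingPong o C τ ℓ X f A) :
    (altCayleyGraph f A).IsTree := by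
  refine ⟨h.connected_altCayleyGraph hY, SimpleGraph.isAcyclic_iff_forall_adj_isBridge.2 ?_⟩
  intro u v huv
  rw [h.altCayleyGraph_adj_iff hY] at huv
  rcases huv with ⟨a, ha, he⟩ | ⟨a, ha, he⟩
  · exact SimpleGraph.isBridge_iff.2 (h.not_reachable_deleteEdges hY ha he)
  · rw [Sym2.eq_swap]
    exact SimpleGraph.isBridge_iff.2 (h.not_reachable_deleteEdges hY ha he)

theorem dist_smul_le_mul_length (hY : IsGeodesicSpace Y) (h : IsPingPong o C τ ℓ X f A)
    {u v : AltVertex f A}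
    (w : (altCayleyGraph f A).Walk u v) :
    dist ((u : G) • o) ((v : G) • o) ≤ (ℓ + 1 + dist o (f • o)) * w.length := by
  have key : ∀ g : G, ∀ a ∈ A,
      dist (g • o) ((g * (a * f)) • o) ≤ ℓ + 1 + dist o (f • o) := fun g a ha => by
    simpa [mul_smul] using h.dist_altProd_le (l := [a]) (by simpa using ha)
  induction w with
  | nil => simp
  | @cons u x v hadj w ih =>
    have h1 : dist ((u : G) • o) ((x : G) • o) ≤ ℓ + 1 + dist o (f • o) := by
      rw [h.altCayleyGraph_adj_iff hY] at hadj
      rcases hadj with ⟨a, ha, he⟩ | ⟨a, ha, he⟩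
      · rw [he]; exact key u a ha
      · rw [he, dist_comm]; exact key x a ha
    push_cast [SimpleGraph.Walk.length_cons]
    linarith [dist_triangle ((u : G) • o) ((x : G) • o) ((v : G) • o)]

theorem isQuasiIsometricEmbedding (hY : IsGeodesicSpace Y) (h : IsPingPong o C τ ℓ X f A) :
    IsQuasiIsometricEmbedding (fun u v => ((altCayleyGraph f A).dist u v : ℝ))
      (fun g => (g : G) • o) := by
  have hτ := h.nonneg
  have hC := h.contracting.nonneg
  set δ := ℓ - (2 * τ + 6 * C) with hδ
  have hδ0 : 0 < δ := by linarith [h.large]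
  set M := ℓ + 1 + dist o (f • o)
  have hM : 0 ≤ M := by
    have := dist_nonneg (x := o) (y := f • o)
    simp only [M]; linarith [h.large]
  set c := 2 * (ℓ + 1) + (2 * τ + 6 * C) with hc
  have hc0 : 0 ≤ c := by linarith [h.large]
  -- The three summands serve `1 ≤ K`, the lower bound `δ` per letter and the upper bound `M` per
  -- edge. The constant `c` is the error where two words diverge after their common prefix.
  refine ⟨1 + δ⁻¹ + M, by linarith [inv_pos.2 hδ0], c, hc0, fun u v => ⟨?_, ?_⟩⟩
  · have hρ : ((altCayleyGraph f A).dist u v : ℝ) / (1 + δ⁻¹ + M) ≤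
        δ * ((altCayleyGraph f A).dist u v : ℝ) := by
      rw [div_le_iff₀ (by positivity)]
      have h1 : δ * δ⁻¹ = 1 := mul_inv_cancel₀ hδ0.ne'
      have h2 : (0 : ℝ) ≤ ((altCayleyGraph f A).dist u v : ℝ) := Nat.cast_nonneg _
      calc ((altCayleyGraph f A).dist u v : ℝ) = δ * ((altCayleyGraph f A).dist u v : ℝ) * δ⁻¹ := by
            rw [mul_right_comm, h1, one_mul]
        _ ≤ _ := by
          gcongr
          linarith
    obtain ⟨lu, hlu, hu⟩ := eq_one_or_mem_closure_altGenerators.1 u.2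
    obtain ⟨lv, hlv, hv⟩ := eq_one_or_mem_closure_altGenerators.1 v.2
    obtain ⟨l, r, s, rfl, rfl, hrs⟩ := List.exists_common_prefix lu lv
    have hl : ∀ a ∈ l, a ∈ A := fun a ha => hlu a (by simp [ha])
    have hr : ∀ a ∈ r, a ∈ A := fun a ha => hlu a (by simp [ha])
    have hs : ∀ a ∈ s, a ∈ A := fun a ha => hlv a (by simp [ha])
    have hx := eq_one_or_mem_closure_altGenerators.2 ⟨l, hl, Eq.refl (altProd f l)⟩
    obtain ⟨w1, hw1⟩ := h.exists_walk hY hr ⟨_, hx⟩ u (by simp [← hu])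
    obtain ⟨w2, hw2⟩ := h.exists_walk hY hs ⟨_, hx⟩ v (by simp [← hv])
    have hd : ((altCayleyGraph f A).dist u v : ℝ) ≤ r.length + s.length := by
      have := SimpleGraph.dist_le (w1.reverse.append w2)
      rw [SimpleGraph.Walk.length_append, SimpleGraph.Walk.length_reverse, hw1, hw2] at this
      exact_mod_cast this
    have e : dist ((u : G) • o) ((v : G) • o) = dist (altProd f r • o) (altProd f s • o) := by
      rw [← hu, ← hv, altProd_append, altProd_append, mul_smul, mul_smul, dist_smul]
    have hr' := h.le_dist_altProd hY hr
    have hs' := h.le_dist_altProd hY hs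
    have hsum : dist o (altProd f r • o) + dist o (altProd f s • o) ≤
        dist (altProd f r • o) (altProd f s • o) + c := by
      cases r with
      | nil => simpa using hc0
      | cons a r => exact h.dist_add_dist_le_of_head_ne hY hr hs (hrs a rfl)
    show _ ≤ dist ((u : G) • o) ((v : G) • o)
    rw [e]
    have : δ * ((altCayleyGraph f A).dist u v : ℝ) ≤ δ * (r.length + s.length) := by gcongr
    linarith
  · obtain ⟨w, hw⟩ := (h.connected_altCayleyGraph hY).exists_walk_length_eq_dist u v
    have := h.dist_smul_le_mul_length hY w
    rw [hw] at this
    have h2 : (0 : ℝ) ≤ ((altCayleyGraph f A).dist u v : ℝ) := Nat.cast_nonneg _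
    calc _ ≤ _ := this
      _ ≤ (1 + δ⁻¹ + M) * ((altCayleyGraph f A).dist u v : ℝ) :=
        mul_le_mul_of_nonneg_right (show M ≤ 1 + δ⁻¹ + M by linarith [inv_pos.2 hδ0]) h2
      _ ≤ _ := by linarith

end IsPingPong
end Semigroup

/-! ### Branches of the Cayley graph -/

section Lipschitz

variable {Y : Type*} [MetricSpace Y]

theorem dist_le_mul_of_forall_nat_Icc {γ : ℝ → Y} {M : ℝ}
    (h : ∀ k : ℕ, ∀ s ∈ Icc (k : ℝ) (k + 1), ∀ t ∈ Icc (k : ℝ) (k + 1),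
      dist (γ s) (γ t) ≤ M * |s - t|) {s t : ℝ} (hs : 0 ≤ s) (hst : s ≤ t) :
    dist (γ s) (γ t) ≤ M * (t - s) := by
  have hbase : ∀ k : ℕ, ∀ s ∈ Icc (k : ℝ) (k + 1), ∀ t ∈ Icc (k : ℝ) (k + 1), s ≤ t →
      dist (γ s) (γ t) ≤ M * (t - s) := fun k s hs t ht hst => by
    have := h k s hs t ht
    rwa [abs_sub_comm, abs_of_nonneg (by linarith)] at this
  have key : ∀ n : ℕ, ∀ t, s ≤ t → t ≤ ⌊s⌋₊ + 1 + n → dist (γ s) (γ t) ≤ M * (t - s) := by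
    intro n
    induction n with
    | zero =>
      intro t hst ht
      have h1 := Nat.floor_le hs
      have h2 := Nat.lt_floor_add_one s
      exact hbase ⌊s⌋₊ s ⟨h1, h2.le⟩ t ⟨h1.trans hst, by simpa using ht⟩ hst
    | succ n ih =>
      intro t hst ht
      push_cast at ht
      rcases le_total t (⌊s⌋₊ + 1 + n) with h1 | h1
      · exact ih t hst h1
      · have h2 := Nat.lt_floor_add_one s
        have h3 : (0 : ℝ) ≤ n := Nat.cast_nonneg n
        have i1 := ih (⌊s⌋₊ + 1 + n) (by linarith) le_rfl
        have e : ((⌊s⌋₊ + 1 + n : ℕ) : ℝ) = ⌊s⌋₊ + 1 + n := by push_cast; ring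
        have i2 := hbase (⌊s⌋₊ + 1 + n) (⌊s⌋₊ + 1 + n) ⟨e.le, by rw [e]; linarith⟩ t
          ⟨by rw [e]; exact h1, by rw [e]; linarith⟩ h1
        linarith [dist_triangle (γ s) (γ (⌊s⌋₊ + 1 + n)) (γ t)]
  obtain ⟨n, hn⟩ := exists_nat_ge t
  refine key n t hst (hn.trans ?_)
  have : (0 : ℝ) ≤ ⌊s⌋₊ := Nat.cast_nonneg _
  linarith

theorem eVariationOn_Icc_le {γ : ℝ → Y} {M : ℝ} (hM : 0 ≤ M) {a b : ℝ} (hab : a ≤ b)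
    (h : LipschitzOnWith M.toNNReal γ (Icc a b)) :
    eVariationOn γ (Icc a b) ≤ ENNReal.ofReal (M * (b - a)) := by
  have h1 := h.comp_eVariationOn_le (mapsTo_id (Icc a b))
  have h2 := ((monotoneOn_id (s := Icc a b)).eVariationOn_eq (left_mem_Icc.2 hab)
    (right_mem_Icc.2 hab)).le
  rw [inter_self] at h2
  rw [ENNReal.ofReal_mul hM]
  exact h1.trans (mul_le_mul_right h2 _)

end Lipschitz

section Branch

variable {G Y : Type*} [Group G] [MetricSpace Y] [MulAction G Y]

theorem exists_branchVertex_add_eq {f : G} {A : Set G} (b : ℕ → altGenerators f A) (i n : ℕ) :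
    ∃ l : List G, (∀ a ∈ l, a ∈ A) ∧ l.length = n ∧
      branchVertex b (i + n) = branchVertex b i * altProd f l := by
  induction n with
  | zero => exact ⟨[], by simp⟩
  | succ n ih =>
    obtain ⟨l, hl, hn, he⟩ := ih
    obtain ⟨a, ha, hab⟩ := (b (i + n)).2
    refine ⟨l ++ [a], fun c hc => ?_, by simp [hn], ?_⟩
    · rcases List.mem_append.1 hc with hc | hc
      · exact hl c hc
      · rwa [List.mem_singleton.1 hc]
    · show branchVertex b (i + n) * b (i + n) = _
      rw [he, ← hab]
      simp [mul_assoc]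

section Path

variable {o : Y} {S : Set G} {σ : S → ℝ → Y} {M : ℝ}

/-- The right endpoint is included although the floor has already jumped there: the end of one edge
is the start of the next. -/
theorem branchPath_eq (hσ : IsGeodesicChoice o S σ) (b : ℕ → S) {k : ℕ} {t : ℝ}
    (ht : t ∈ Icc (k : ℝ) (k + 1)) :
    branchPath o σ b t = branchVertex b k • σ (b k) ((t - k) * dist o ((b k : G) • o)) := by
  rcases ht.2.lt_or_eq with h | h
  · have : ⌊t⌋₊ = k := (Nat.floor_eq_iff (k.cast_nonneg.trans ht.1)).2 ⟨ht.1, h⟩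
    simp only [branchPath, orbitalMapEdge, this]
  · have : ⌊t⌋₊ = k + 1 := by rw [h]; exact_mod_cast Nat.floor_natCast (R := ℝ) (k + 1)
    simp only [branchPath, orbitalMapEdge, this]
    rw [h]
    push_cast
    rw [sub_self, zero_mul, (hσ (b (k + 1))).2.1, add_sub_cancel_left, one_mul, (hσ (b k)).2.2]
    simp [branchVertex, mul_smul]

theorem branchPath_natCast (hσ : IsGeodesicChoice o S σ) (b : ℕ → S) (k : ℕ) :
    branchPath o σ b k = branchVertex b k • o := by
  rw [branchPath_eq hσ b (k := k) ⟨le_rfl, by linarith⟩, sub_self, zero_mul, (hσ (b k)).2.1]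

variable [IsIsometricSMul G Y]

theorem dist_branchPath (hσ : IsGeodesicChoice o S σ) (b : ℕ → S) {k : ℕ} {s t : ℝ}
    (hs : s ∈ Icc (k : ℝ) (k + 1)) (ht : t ∈ Icc (k : ℝ) (k + 1)) :
    dist (branchPath o σ b s) (branchPath o σ b t) = dist o ((b k : G) • o) * |s - t| := by
  have hd := dist_nonneg (x := o) (y := (b k : G) • o)
  have hmem : ∀ t ∈ Icc (k : ℝ) (k + 1),
      (t - k) * dist o ((b k : G) • o) ∈ Icc 0 (dist o ((b k : G) • o)) := fun t ht =>
    ⟨mul_nonneg (by linarith [ht.1]) hd, by nlinarith [ht.2]⟩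
  rw [branchPath_eq hσ b hs, branchPath_eq hσ b ht, dist_smul,
    (hσ (b k)).1 _ (hmem s hs) _ (hmem t ht), ← sub_mul, abs_mul, abs_of_nonneg hd,
    sub_sub_sub_cancel_right, mul_comm]

theorem dist_branchPath_le (hσ : IsGeodesicChoice o S σ)
    (hM : ∀ s : S, dist o ((s : G) • o) ≤ M) (b : ℕ → S) {s t : ℝ} (hs : 0 ≤ s) (ht : 0 ≤ t) :
    dist (branchPath o σ b s) (branchPath o σ b t) ≤ M * |s - t| := by
  have key : ∀ k : ℕ, ∀ s ∈ Icc (k : ℝ) (k + 1), ∀ t ∈ Icc (k : ℝ) (k + 1),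
      dist (branchPath o σ b s) (branchPath o σ b t) ≤ M * |s - t| := fun k s hs t ht => by
    rw [dist_branchPath hσ b hs ht]
    exact mul_le_mul_of_nonneg_right (hM _) (abs_nonneg _)
  rcases le_total s t with h | h
  · rw [abs_sub_comm, abs_of_nonneg (by linarith)]
    exact dist_le_mul_of_forall_nat_Icc key hs h
  · rw [abs_of_nonneg (by linarith), dist_comm]
    exact dist_le_mul_of_forall_nat_Icc key ht h

theorem lipschitzOnWith_branchPath (hσ : IsGeodesicChoice o S σ) (hM0 : 0 ≤ M)
    (hM : ∀ s : S, dist o ((s : G) • o) ≤ M) (b : ℕ → S) :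
    LipschitzOnWith M.toNNReal (branchPath o σ b) (Ici 0) :=
  LipschitzOnWith.of_dist_le_mul fun s hs t ht => by
    rw [Real.coe_toNNReal _ hM0]
    exact dist_branchPath_le hσ hM b hs ht

theorem mem_Icc_floor {t : ℝ} (ht : 0 ≤ t) : t ∈ Icc (⌊t⌋₊ : ℝ) (⌊t⌋₊ + 1) :=
  ⟨Nat.floor_le ht, (Nat.lt_floor_add_one t).le⟩

theorem dist_branchPath_floor_le (hσ : IsGeodesicChoice o S σ)
    (hM : ∀ s : S, dist o ((s : G) • o) ≤ M) (b : ℕ → S) {t : ℝ} (ht : 0 ≤ t) :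
    dist (branchPath o σ b t) (branchVertex b ⌊t⌋₊ • o) ≤ M := by
  rw [← branchPath_natCast hσ, dist_branchPath hσ b (mem_Icc_floor ht) ⟨le_rfl, by linarith⟩]
  have h1 := mem_Icc_floor ht
  rw [abs_of_nonneg (by linarith [h1.1])]
  refine le_trans (mul_le_of_le_one_right dist_nonneg (by linarith [h1.2])) (hM _)

theorem branchPath_between (hσ : IsGeodesicChoice o S σ) (b : ℕ → S) {t : ℝ} (ht : 0 ≤ t) :
    dist (branchVertex b ⌊t⌋₊ • o) (branchPath o σ b t) +
      dist (branchPath o σ b t) (branchVertex b (⌊t⌋₊ + 1) • o) =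
      dist (branchVertex b ⌊t⌋₊ • o) (branchVertex b (⌊t⌋₊ + 1) • o) := by
  have h1 := mem_Icc_floor ht
  have h0 : (⌊t⌋₊ : ℝ) ∈ Icc (⌊t⌋₊ : ℝ) (⌊t⌋₊ + 1) := ⟨le_rfl, by linarith⟩
  have h2 : ((⌊t⌋₊ + 1 : ℕ) : ℝ) ∈ Icc (⌊t⌋₊ : ℝ) (⌊t⌋₊ + 1) := by
    push_cast; exact ⟨by linarith, le_rfl⟩
  rw [← branchPath_natCast hσ, ← branchPath_natCast hσ, dist_branchPath hσ b h0 h1,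
    dist_branchPath hσ b h1 h2, dist_branchPath hσ b h0 h2, ← mul_add,
    abs_of_nonpos (by linarith [h1.1]), abs_of_nonpos (by push_cast; linarith [h1.2]),
    abs_of_nonpos (by push_cast; linarith)]
  ring

end Path

namespace IsPingPong

variable [IsIsometricSMul G Y] {o : Y} {C τ ℓ : ℝ} {X : Set Y} {f : G} {A : Set G}

theorem le_dist_branchVertex (hY : IsGeodesicSpace Y) (h : IsPingPong o C τ ℓ X f A)
    (b : ℕ → altGenerators f A) {i j : ℕ} (hij : i ≤ j) :
    ((j : ℝ) - i) * (ℓ - (2 * τ + 6 * C)) ≤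
      dist (branchVertex b i • o) (branchVertex b j • o) := by
  obtain ⟨n, rfl⟩ := Nat.exists_eq_add_of_le hij
  obtain ⟨l, hl, hn, he⟩ := exists_branchVertex_add_eq b i n
  have := h.le_dist_altProd hY hl
  rw [he, mul_smul, dist_smul]
  push_cast
  rwa [add_sub_cancel_left, ← hn]

theorem dist_generator_le (h : IsPingPong o C τ ℓ X f A) (s : altGenerators f A) :
    dist o ((s : G) • o) ≤ ℓ + 1 + dist o (f • o) := by
  obtain ⟨a, ha, he⟩ := s.2
  rw [← he]
  simpa using h.dist_altProd_le (l := [a]) (by simpa using ha)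

theorem isQuasiGeodesicPath_branchPath (hY : IsGeodesicSpace Y) (h : IsPingPong o C τ ℓ X f A) :
    ∃ c : ℝ, 1 ≤ c ∧ ∀ σ : altGenerators f A → ℝ → Y, IsGeodesicChoice o (altGenerators f A) σ →
      ∀ b : ℕ → altGenerators f A, IsQuasiGeodesicPath c (branchPath o σ b) (Ici 0) := by
  have hτ := h.nonneg
  have hC := h.contracting.nonneg
  set δ := ℓ - (2 * τ + 6 * C) with hδ
  have hδ0 : 0 < δ := by linarith [h.large]
  set M := ℓ + 1 + dist o (f • o) with hMdef
  have hM : 0 ≤ M := by linarith [h.large, dist_nonneg (x := o) (y := f • o)]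
  -- The length is at most `M (t - s)` and `t - s ≤ (d + 2M) / δ + 1`, where `2M` accounts for
  -- moving the endpoints to vertices; the constant dominates both coefficients in `d`.
  refine ⟨1 + M + M / δ * (1 + 2 * M), ?_, fun σ hσ b => ?_⟩
  · have : 0 ≤ M / δ * (1 + 2 * M) := by positivity
    linarith
  have hlip := lipschitzOnWith_branchPath hσ hM h.dist_generator_le b
  refine ⟨hlip.continuousOn, fun s hs t ht hst => ?_⟩
  refine (eVariationOn_Icc_le hM hst (hlip.mono fun r hr => le_trans hs hr.1)).trans
    (ENNReal.ofReal_le_ofReal ?_)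
  have i1 := h.le_dist_branchVertex hY b (Nat.floor_mono hst)
  have i2 := dist_branchPath_floor_le hσ h.dist_generator_le b hs
  have i3 := dist_branchPath_floor_le hσ h.dist_generator_le b ht
  have i4 : t - s ≤ (⌊t⌋₊ : ℝ) - ⌊s⌋₊ + 1 := by
    linarith [Nat.floor_le (show (0 : ℝ) ≤ s from hs), Nat.lt_floor_add_one t]
  set d := dist (branchPath o σ b s) (branchPath o σ b t)
  have hd : 0 ≤ d := dist_nonneg
  have i5 : ((⌊t⌋₊ : ℝ) - ⌊s⌋₊) ≤ (d + 2 * M) / δ := by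
    rw [le_div_iff₀ hδ0]
    refine i1.trans ?_
    linarith [dist_triangle4 (branchVertex b ⌊s⌋₊ • o) (branchPath o σ b s) (branchPath o σ b t)
      (branchVertex b ⌊t⌋₊ • o), dist_comm (branchVertex b ⌊s⌋₊ • o) (branchPath o σ b s)]
  have i6 : M * (t - s) ≤ M * ((d + 2 * M) / δ + 1) := by gcongr; linarith
  have e : M * ((d + 2 * M) / δ + 1) = M / δ * d + M / δ * (2 * M) + M := by field_simp
  have n1 : 0 ≤ M / δ := by positivity
  have n2 : 0 ≤ M / δ * (2 * M) * d := by positivity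
  have n3 : 0 ≤ M * d := by positivity
  nlinarith

theorem projectsNear_branchVertex_left (hY : IsGeodesicSpace Y) (h : IsPingPong o C τ ℓ X f A)
    (b : ℕ → altGenerators f A) {i k : ℕ} (hik : i ≤ k) {a : G} (ha : a ∈ A) :
    ProjectsNear X o (τ + C) ((branchVertex b k * a)⁻¹ • branchVertex b i • o) := by
  obtain ⟨n, rfl⟩ := Nat.exists_eq_add_of_le hik
  obtain ⟨l, hl, hn, he⟩ := exists_branchVertex_add_eq b i n
  have := h.projectsNear_inv_smul_inv_smul hY hl ha
  rw [he]
  simpa [mul_smul, mul_assoc] using this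

theorem projectsNear_branchVertex_right (hY : IsGeodesicSpace Y) (h : IsPingPong o C τ ℓ X f A)
    (b : ℕ → altGenerators f A) {i k : ℕ} (hik : i ≤ k) :
    ProjectsNear X o (τ + C) ((branchVertex b i)⁻¹ • branchVertex b k • o) := by
  obtain ⟨n, rfl⟩ := Nat.exists_eq_add_of_le hik
  obtain ⟨l, hl, hn, he⟩ := exists_branchVertex_add_eq b i n
  have := h.projectsNear_smul hY hl
  rw [he]
  simpa [mul_smul, mul_assoc] using this

/-- A geodesic whose endpoints have nearest points on a branch far apart along the branch passes
near the branch. -/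
theorem exists_dist_branchVertex_le (hY : IsGeodesicSpace Y) (h : IsPingPong o C τ ℓ X f A)
    {σ : altGenerators f A → ℝ → Y} (hσ : IsGeodesicChoice o (altGenerators f A) σ)
    (b : ℕ → altGenerators f A) {n : ℕ}
    (hn : 2 * (ℓ + 1 + dist o (f • o)) + dist o (f • o) + 2 * τ + 8 * C <
      n * (ℓ - (2 * τ + 6 * C)))
    {u v : ℝ} (hu : 0 ≤ u) (hv : 0 ≤ v) (huv : ⌊u⌋₊ + 2 * n + 1 ≤ ⌊v⌋₊) {ζ : ℝ → Y} {s t : ℝ}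
    (hζ : IsGeodesicOn ζ (uIcc s t))
    (hp : IsNearestPoint (branchPath o σ b '' Ici 0) (ζ s) (branchPath o σ b u))
    (hq : IsNearestPoint (branchPath o σ b '' Ici 0) (ζ t) (branchPath o σ b v)) :
    ∃ r ∈ uIcc s t, ∃ z ∈ branchPath o σ b '' Ici 0, dist (ζ r) z ≤ 5 * C + τ := by
  have hX := h.contracting
  have hτ := h.nonneg
  have hC := hX.nonneg
  have hf := dist_nonneg (x := o) (y := f • o)
  have hn1 : 1 ≤ n := by
    rcases Nat.eq_zero_or_pos n with rfl | h1
    · rw [Nat.cast_zero, zero_mul] at hn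
      linarith [h.large]
    · exact h1
  -- The relevant translate is `w • X`, crossed by the path in edge `k`, at least `n` edges away
  -- from both parameters. Earlier parts of the branch project near `w • o`, later parts near `w f
  -- o`, the next vertex.
  set j := ⌊u⌋₊ with hj
  set k := j + n with hk
  obtain ⟨a, ha, hab⟩ := (b k).2
  set w := branchVertex b k * a with hw
  have hv1 : branchVertex b (k + 1) = w * f := by
    show branchVertex b k * b k = _
    rw [← hab, hw, mul_assoc]
  have hvP : ∀ i, branchVertex b i • o ∈ branchPath o σ b '' Ici 0 := fun i =>
    ⟨i, Nat.cast_nonneg (α := ℝ) i, branchPath_natCast hσ b i⟩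
  have hwf : dist (w • o) (branchVertex b (k + 1) • o) = dist o (f • o) := by
    rw [hv1, mul_smul w f, dist_smul]
  -- the first nearest point
  have f1 : 2 * (τ + C) + 6 * C + dist o (f • o) < dist (branchPath o σ b u) (w • o) := by
    have i1 := h.le_dist_branchVertex hY b (Nat.le_add_right j n)
    have i2 := dist_branchPath_floor_le hσ h.dist_generator_le b hu
    have i3 : dist (branchVertex b k • o) (w • o) ≤ ℓ + 1 := by
      rw [hw, mul_smul, dist_smul]; exact h.dist_le a ha
    push_cast at i1
    rw [add_sub_cancel_left] at i1
    linarith [dist_triangle4 (branchVertex b j • o) (branchPath o σ b u) (w • o)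
      (branchVertex b k • o), dist_comm (branchVertex b j • o) (branchPath o σ b u),
      dist_comm (w • o) (branchVertex b k • o)]
  have e1 : ∀ y : Y, dist (w⁻¹ • y) o = dist y (w • o) := fun y => by
    rw [← dist_smul w, smul_inv_smul]
  have p1 : ProjectsNear X o (τ + C + C) (w⁻¹ • branchPath o σ b u) :=
    hX.projectsNear_of_between hY
      (h.projectsNear_branchVertex_left hY b (i := j) (k := k) (by omega) ha)
      (h.projectsNear_branchVertex_left hY b (i := j + 1) (k := k) (by omega) ha)
      (by simpa only [hw, dist_smul] using branchPath_between hσ b hu) (by rw [e1]; linarith)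
  -- The point `w • o` need not lie on the branch, so minimality is tested against `w f o`; this is
  -- the source of the slack `d(o, f o)`.
  have p2 : ProjectsNear X o (τ + C + C + C) (w⁻¹ • ζ s) := by
    refine hX.projectsNear_of_dist_le hY (M := dist o (f • o)) p1 ?_ (by rw [e1]; linarith)
    rw [dist_smul, e1]
    linarith [hp.dist_le (hvP (k + 1)), dist_triangle (ζ s) (w • o) (branchVertex b (k + 1) • o)]
  -- the second nearest point
  set g := branchVertex b (k + 1) with hg
  have e2 : ∀ y : Y, dist (g⁻¹ • y) o = dist y (g • o) := fun y => by
    rw [← dist_smul g, smul_inv_smul]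
  have f2 : 2 * (τ + C) + 6 * C < dist (branchPath o σ b v) (g • o) := by
    have i1 := h.le_dist_branchVertex hY b (i := k + 1) (j := ⌊v⌋₊) (by omega)
    have i2 := dist_branchPath_floor_le hσ h.dist_generator_le b hv
    have i3 : (n : ℝ) ≤ (⌊v⌋₊ : ℝ) - (k + 1 : ℕ) := by
      rw [le_sub_iff_add_le]
      exact_mod_cast (show n + (k + 1) ≤ ⌊v⌋₊ by omega)
    have i4 := mul_le_mul_of_nonneg_right i3
      (show 0 ≤ ℓ - (2 * τ + 6 * C) by linarith [h.large])
    linarith [dist_triangle (g • o) (branchPath o σ b v) (branchVertex b ⌊v⌋₊ • o),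
      dist_comm (g • o) (branchPath o σ b v), h.large]
  have q1 : ProjectsNear X o (τ + C + C) (g⁻¹ • branchPath o σ b v) :=
    hX.projectsNear_of_between hY
      (h.projectsNear_branchVertex_right hY b (i := k + 1) (k := ⌊v⌋₊) (by omega))
      (h.projectsNear_branchVertex_right hY b (i := k + 1) (k := ⌊v⌋₊ + 1) (by omega))
      (by simpa only [hg, dist_smul] using branchPath_between hσ b hv) (by rw [e2]; linarith)
  have q2 : ProjectsNear X o (τ + C + C + C) (g⁻¹ • ζ t) := by
    refine hX.projectsNear_of_dist_le hY (M := 0) q1 ?_ (by rw [e2]; linarith)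
    rw [dist_smul, e2, add_zero]
    exact hq.dist_le (hvP _)
  rw [hv1, mul_inv_rev, mul_smul] at q2
  obtain ⟨x', hx'⟩ := hX.exists_nearest (w⁻¹ • ζ s)
  obtain ⟨y', hy'⟩ := hX.exists_nearest (w⁻¹ • ζ t)
  -- The full `7C` in `long` is used here, as `2(τ + 3C) + C`.
  have hlt := h.lt_dist_nearest (by linarith [h.long]) p2 q2 hx' hy'
  have hyf := h.dist_smul_le q2 hy'
  have hr : ∃ r ∈ uIcc s t, dist (w⁻¹ • ζ r) y' ≤ 2 * C := by
    rcases le_total s t with hst | hst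
    · rw [uIcc_of_le hst] at hζ ⊢
      exact hX.exists_dist_le_right hst (hζ.smul w⁻¹) hx' hy' hlt
    · rw [uIcc_of_ge hst] at hζ ⊢
      exact hX.exists_dist_le_left hst (hζ.smul w⁻¹) hy' hx' (by rwa [dist_comm])
  obtain ⟨r, hr, hd⟩ := hr
  refine ⟨r, hr, g • o, hvP _, ?_⟩
  rw [hv1, mul_smul, ← dist_smul w⁻¹, inv_smul_smul]
  linarith [dist_triangle (w⁻¹ • ζ r) y' (f • o)]

theorem isContractingWith_branchPath (hY : IsGeodesicSpace Y) (h : IsPingPong o C τ ℓ X f A) :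
    ∃ D : ℝ, 1 ≤ D ∧ ∀ σ : altGenerators f A → ℝ → Y, IsGeodesicChoice o (altGenerators f A) σ →
      ∀ b : ℕ → altGenerators f A, IsContractingWith D (branchPath o σ b '' Ici 0) := by
  have hτ := h.nonneg
  have hC := h.contracting.nonneg
  have hδ0 : 0 < ℓ - (2 * τ + 6 * C) := by linarith [h.large]
  have hM : 0 ≤ ℓ + 1 + dist o (f • o) := by
    linarith [h.large, dist_nonneg (x := o) (y := f • o)]
  obtain ⟨n, hn⟩ := exists_nat_gt
    ((2 * (ℓ + 1 + dist o (f • o)) + dist o (f • o) + 2 * τ + 8 * C) / (ℓ - (2 * τ + 6 * C)))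
  rw [div_lt_iff₀ hδ0] at hn
  have hn0 : 0 ≤ (ℓ + 1 + dist o (f • o)) * (2 * n + 2) := by positivity
  -- Either the parameters differ by at most `2n + 2` and the Lipschitz bound applies, or the
  -- geodesic comes within `5C + τ` of the branch, which is excluded.
  refine ⟨1 + (5 * C + τ) + (ℓ + 1 + dist o (f • o)) * (2 * n + 2), by linarith,
    fun σ hσ b ζ I hI hζ hfar x hx y hy => ?_⟩
  have key : ∀ u v : ℝ, 0 ≤ u → 0 ≤ v → u ≤ v → ∀ s ∈ I, ∀ t ∈ I,
      IsNearestPoint (branchPath o σ b '' Ici 0) (ζ s) (branchPath o σ b u) →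
      IsNearestPoint (branchPath o σ b '' Ici 0) (ζ t) (branchPath o σ b v) →
      dist (branchPath o σ b u) (branchPath o σ b v) ≤
        1 + (5 * C + τ) + (ℓ + 1 + dist o (f • o)) * (2 * n + 2) := by
    intro u v hu hv huv s hs t ht hp hq
    by_cases hfl : ⌊u⌋₊ + 2 * n + 1 ≤ ⌊v⌋₊
    · obtain ⟨r, hr, z, hz, hd⟩ := h.exists_dist_branchVertex_le hY hσ b hn hu hv hfl
        (hζ.mono (hI.uIcc_subset hs ht)) hp hq
      have := hfar _ ⟨r, hI.uIcc_subset hs ht hr, rfl⟩ z hz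
      linarith
    · have h1 : v - u ≤ 2 * n + 2 := by
        have h2 : (⌊v⌋₊ : ℝ) ≤ ⌊u⌋₊ + 2 * n := by exact_mod_cast (by omega)
        linarith [Nat.floor_le hu, Nat.lt_floor_add_one v]
      have h2 := dist_branchPath_le hσ h.dist_generator_le b hu hv
      rw [abs_sub_comm, abs_of_nonneg (by linarith)] at h2
      have h3 := mul_le_mul_of_nonneg_left h1 hM
      linarith
  obtain ⟨⟨u, hu, rfl⟩, p, ⟨s, hs, rfl⟩, hp⟩ := hx
  obtain ⟨⟨v, hv, rfl⟩, q, ⟨t, ht, rfl⟩, hq⟩ := hy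
  rcases le_total u v with huv | huv
  · exact key u v hu hv huv s hs t ht ⟨mem_image_of_mem _ hu, hp⟩ ⟨mem_image_of_mem _ hv, hq⟩
  · rw [dist_comm]
    exact key v u hv hu huv t ht s hs ⟨mem_image_of_mem _ hv, hq⟩ ⟨mem_image_of_mem _ hu, hp⟩

end IsPingPong
end Branch

/-! ### Contracting elements -/

section Commensurating

variable {G : Type*} [Group G]

/-- The subgroup of the elements that conjugate some non-trivial power of `h` to a non-trivial
power of `h`. -/
def commensuratingSubgroup (h : G) : Subgroup G where
  carrier := {g | ∃ m n : ℤ, m ≠ 0 ∧ n ≠ 0 ∧ g * h ^ m * g⁻¹ = h ^ n}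
  one_mem' := ⟨1, 1, one_ne_zero, one_ne_zero, by simp⟩
  mul_mem' := by
    rintro a b ⟨m, n, hm, hn, hab⟩ ⟨m', n', hm', hn', hab'⟩
    refine ⟨m' * m, n * n', mul_ne_zero hm' hm, mul_ne_zero hn hn', ?_⟩
    have e1 : b * h ^ (m' * m) * b⁻¹ = h ^ (n' * m) := by
      rw [zpow_mul, ← conj_zpow, hab', zpow_mul]
    have e2 : a * h ^ (n' * m) * a⁻¹ = h ^ (n * n') := by
      rw [mul_comm n', zpow_mul, ← conj_zpow, hab, zpow_mul]
    rw [← e2, ← e1]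
    group
  inv_mem' := by
    rintro a ⟨m, n, hm, hn, hab⟩
    exact ⟨n, m, hn, hm, by rw [← hab]; group⟩

end Commensurating

section ProperAction

variable {G Y : Type*} [Group G] [MetricSpace Y] [ProperSpace Y] [MulAction G Y]
  [ProperlyDiscontinuousSMul G Y]

theorem finite_setOf_dist_smul_le (p q : Y) (r : ℝ) : {g : G | dist p (g • q) ≤ r}.Finite := by
  refine (finite_disjoint_inter_image (Γ := G) (isCompact_singleton (x := q))
    (isCompact_closedBall p r)).subset fun g hg => ?_
  have hmem : g • q ∈ Metric.closedBall p r := by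
    rw [Metric.mem_closedBall, dist_comm]
    exact hg
  rw [mem_ofPred_eq]
  exact ⟨g • q, mem_image_of_mem _ (mem_singleton q), hmem⟩

end ProperAction

/-! ### Axes of contracting elements and independent translates -/

section Contracting

open scoped Pointwise

variable {G Y : Type*} [Group G] [MulAction G Y]

/-- The orbit of `x` under the cyclic group generated by `h`. -/
def zpowersOrbit (h : G) (x : Y) : Set Y := range fun n : ℤ => h ^ n • x

theorem mem_smul_zpowersOrbit {g h : G} {x y : Y} :
    y ∈ g • zpowersOrbit h x ↔ ∃ n : ℤ, g • h ^ n • x = y := by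
  simp [zpowersOrbit, mem_smul_set]

theorem smul_zpowersOrbit_self (h : G) (x : Y) (n : ℤ) :
    h ^ n • zpowersOrbit h x = zpowersOrbit h x := by
  ext y
  rw [mem_smul_zpowersOrbit]
  constructor
  · rintro ⟨m, rfl⟩
    exact ⟨n + m, by simp [zpow_add, mul_smul]⟩
  · rintro ⟨m, rfl⟩
    exact ⟨m - n, by simp [smul_smul, ← zpow_add]⟩

variable [MetricSpace Y]

/-- The orbit of `x` under `h` is `C`-contracting and quasi-isometrically embedded. -/
structure IsContractingAxis (C : ℝ) (h : G) (x : Y) : Prop where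
  contracting : IsProximinalContracting C (zpowersOrbit h x)
  exists_le_dist : ∃ K c : ℝ, 0 < K ∧ ∀ n : ℤ, |(n : ℝ)| / K - c ≤ dist x (h ^ n • x)

theorem IsContractingElement.exists_isContractingAxis {h : G} (hh : IsContractingElement Y h) :
    ∃ (C : ℝ) (x : Y), IsContractingAxis C h x := by
  obtain ⟨x, ⟨C, hC, hX⟩, K, hK, c, hc, hqi⟩ := hh
  have hdist : ∀ n : ℤ, |(n : ℝ)| / K - c ≤ dist x (h ^ n • x) := fun n => by
    have := (hqi 0 n).1
    simpa using this
  refine ⟨C, x, ⟨by linarith, hX, fun p => ?_⟩, K, c, by linarith, hdist⟩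
  -- Nearest points exist because only finitely many orbit points compete with `x`.
  have hfin : {n : ℤ | dist p (h ^ n • x) ≤ dist p x}.Finite := by
    refine (Set.finite_Icc (-⌈K * (2 * dist p x + c)⌉) ⌈K * (2 * dist p x + c)⌉).subset
      fun n hn => ?_
    rw [mem_ofPred_eq] at hn
    have h1 := hdist n
    have h2 : |(n : ℝ)| ≤ K * (2 * dist p x + c) := by
      rw [mul_comm, ← div_le_iff₀ (by linarith)]
      linarith [dist_triangle x p (h ^ n • x), dist_comm x p]
    have h3 := h2.trans (Int.le_ceil _)
    rw [abs_le] at h3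
    exact ⟨by exact_mod_cast h3.1, by exact_mod_cast h3.2⟩
  obtain ⟨n, hn, hmin⟩ := Set.exists_min_image _ (fun n : ℤ => dist p (h ^ n • x)) hfin
    ⟨0, by simp⟩
  refine ⟨h ^ n • x, isNearestPoint_iff.2 ⟨⟨n, rfl⟩, ?_⟩⟩
  rintro _ ⟨m, rfl⟩
  by_cases hm : dist p (h ^ m • x) ≤ dist p x
  · exact hmin m hm
  · exact le_trans hn (not_le.1 hm).le

namespace IsContractingAxis

variable {C : ℝ} {h : G} {x : Y}

theorem exists_lt_dist (hh : IsContractingAxis C h x) (B : ℝ) :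
    ∃ N : ℕ, ∀ n : ℤ, (N : ℤ) ≤ |n| → B < dist x (h ^ n • x) := by
  obtain ⟨K, c, hK, hd⟩ := hh.exists_le_dist
  obtain ⟨N, hN⟩ := exists_nat_gt ((B + c) * K)
  refine ⟨N, fun n hn => ?_⟩
  have h1 : (N : ℝ) ≤ |(n : ℝ)| := by exact_mod_cast hn
  have h2 : B + c < |(n : ℝ)| / K := by
    rw [lt_div_iff₀ hK]; linarith
  linarith [hd n]

theorem zpow_injective (hh : IsContractingAxis C h x) :
    Function.Injective fun n : ℤ => h ^ n := by
  intro m n hmn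
  by_contra hne
  obtain ⟨N, hN⟩ := hh.exists_lt_dist 0
  have h1 : h ^ (m - n) = 1 := by
    rw [zpow_sub]; exact mul_inv_eq_one.2 hmn
  have h2 := hN ((m - n) * N) (by
    rw [abs_mul, Nat.abs_cast]
    exact le_mul_of_one_le_left (by positivity) (Int.one_le_abs (sub_ne_zero.2 hne)))
  rw [zpow_mul, h1] at h2
  simp at h2

/-- A coincidence gives `g h^(j - j') g⁻¹ = h^(i' - i)`; since `g` is not commensurating one
exponent vanishes, and then so does the other because `h` has infinite order. -/
theorem mul_zpow_mul_injective (hh : IsContractingAxis C h x) {g : G}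
    (hg : g ∉ commensuratingSubgroup h) :
    Function.Injective fun k : ℤ × ℤ => h ^ k.1 * g * h ^ k.2 := by
  rintro ⟨i, j⟩ ⟨i', j'⟩ he
  have he : h ^ i * g * h ^ j = h ^ i' * g * h ^ j' := he
  have e1 : g * h ^ (j - j') * g⁻¹ = h ^ (i' - i) := by
    rw [zpow_sub, zpow_sub, ← zpow_neg, ← zpow_neg]
    calc _ = h ^ (-i) * (h ^ i * g * h ^ j) * h ^ (-j') * g⁻¹ := by group
      _ = _ := by rw [he]; group
  by_cases hj : j = j'
  · rw [hj, sub_self, zpow_zero, mul_one, mul_inv_cancel] at e1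
    have := hh.zpow_injective (a₁ := 0) (a₂ := i' - i) (by simpa using e1)
    rw [hj, show i = i' by omega]
  · by_cases hi : i = i'
    · rw [hi, sub_self, zpow_zero, mul_inv_eq_one, mul_eq_left] at e1
      have := hh.zpow_injective (a₁ := j - j') (a₂ := 0) (by simpa using e1)
      rw [hi, show j = j' by omega]
    · exact absurd ⟨j - j', i' - i, sub_ne_zero.2 hj, sub_ne_zero.2 (Ne.symm hi), e1⟩ hg

variable [IsIsometricSMul G Y]

theorem _root_.dist_zpow_smul_zpow_smul (h : G) (x : Y) (m n : ℤ) :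
    dist (h ^ m • x) (h ^ n • x) = dist x (h ^ (n - m) • x) := by
  rw [← dist_smul (h ^ (-m)), smul_smul, smul_smul, ← zpow_add, ← zpow_add]
  simp [sub_eq_neg_add]

/-- Up to powers of `h` on the left, only the finitely many residues of `k` modulo `m` matter. The
bound depends on `g`; `infDist_smul_le` makes it uniform. -/
theorem _root_.exists_infDist_le_of_mem_commensuratingSubgroup {g : G}
    (hg : g ∈ commensuratingSubgroup h) (x : Y) :
    ∃ B, ∀ k : ℤ, Metric.infDist (g • h ^ k • x) (zpowersOrbit h x) ≤ B := by
  obtain ⟨m, n, hm, hn, he⟩ := hg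
  obtain ⟨B, hB⟩ := ((Set.finite_Ico 0 |m|).image
    fun r : ℤ => dist (g • h ^ r • x) x).bddAbove
  refine ⟨B, fun k => ?_⟩
  have hr : k % m ∈ Ico 0 |m| := ⟨Int.emod_nonneg k hm, Int.emod_lt_abs k hm⟩
  have e1 : g * h ^ k = h ^ (n * (k / m)) * (g * h ^ (k % m)) := by
    conv_lhs => rw [← Int.mul_ediv_add_emod k m]
    have : g * h ^ (m * (k / m)) = h ^ (n * (k / m)) * g := by
      rw [zpow_mul h n, ← he, conj_zpow, ← zpow_mul]
      group
    rw [zpow_add, ← mul_assoc, this, mul_assoc]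
  have e2 : g • h ^ k • x = h ^ (n * (k / m)) • g • h ^ (k % m) • x := by
    simp only [smul_smul, e1]
  rw [e2, ← smul_zpowersOrbit_self h x (n * (k / m)), infDist_smul_set]
  exact (Metric.infDist_le_dist_of_mem (show x ∈ zpowersOrbit h x from ⟨0, by simp⟩)).trans
    (hB ⟨k % m, hr, rfl⟩)

/-- The elements of the commensurating subgroup move the base point uniformly close to the
axis. -/
theorem infDist_smul_le (hY : IsGeodesicSpace Y) (hh : IsContractingAxis C h x) {g : G}
    (hg : g ∈ commensuratingSubgroup h) :
    Metric.infDist (g • x) (zpowersOrbit h x) ≤ 34 * C := by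
  have hX := hh.contracting
  have hC := hX.nonneg
  obtain ⟨B, hB⟩ := exists_infDist_le_of_mem_commensuratingSubgroup hg x
  obtain ⟨y', hy'⟩ := hX.exists_nearest (g • x)
  obtain ⟨N, hN⟩ := hh.exists_lt_dist (C + B + dist (g • x) y')
  have hfar : ∀ k : ℤ, (N : ℤ) ≤ |k| → ∃ z, IsNearestPoint (zpowersOrbit h x) (g • h ^ k • x) z ∧
      C < dist y' z := fun k hk => by
    obtain ⟨z, hz⟩ := hX.exists_nearest (g • h ^ k • x)
    refine ⟨z, hz, ?_⟩
    have h1 := hN k hk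
    have h2 := hB k
    rw [← hz.2] at h2
    have e : dist (g • x) (g • h ^ k • x) = dist x (h ^ k • x) := dist_smul _ _ _
    linarith [dist_triangle4 (g • x) y' z (g • h ^ k • x), dist_comm z (g • h ^ k • x)]
  have hgX := hX.smul g
  have hmem : ∀ k : ℤ, g • h ^ k • x ∈ g • zpowersOrbit h x := fun k =>
    mem_smul_zpowersOrbit.2 ⟨k, rfl⟩
  have hmem0 : g • x ∈ g • zpowersOrbit h x := by simpa using hmem 0
  -- the projection of `g x` is close to the translated axis
  have hclose : Metric.infDist y' (g • zpowersOrbit h x) ≤ 10 * C := by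
    obtain ⟨z, hz, hyz⟩ := hfar N (by simp)
    obtain ⟨γ, hγ, h0, h1⟩ := hY (g • x) (g • h ^ (N : ℤ) • x)
    obtain ⟨t, ht, hd⟩ := hX.exists_dist_le_left dist_nonneg hγ (by rwa [h0]) (by rwa [h1]) hyz
    have hbet : dist (g • x) (γ t) + dist (γ t) (g • h ^ (N : ℤ) • x) =
        dist (g • x) (g • h ^ (N : ℤ) • x) := by
      have e0 := hγ 0 ⟨le_rfl, dist_nonneg⟩ t ht
      have e1 := hγ t ht _ ⟨dist_nonneg, le_rfl⟩
      rw [h0, zero_sub, abs_neg, abs_of_nonneg ht.1] at e0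
      rw [h1, abs_sub_comm, abs_of_nonneg (by linarith [ht.2])] at e1
      linarith
    have := hgX.infDist_le_of_between hY (r := 0) (Metric.infDist_zero_of_mem hmem0).le
      (Metric.infDist_zero_of_mem (hmem N)).le hbet
    linarith [Metric.infDist_le_infDist_add_dist (s := g • zpowersOrbit h x) (x := y') (y := γ t),
      dist_comm y' (γ t)]
  obtain ⟨y'', hy''⟩ := hgX.exists_nearest y'
  rw [← hy''.2] at hclose
  obtain ⟨i, rfl⟩ := mem_smul_zpowersOrbit.1 hy''.1
  -- The error is `4C` plus twice the distance `10C` from `y'` to `g h^i x`.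
  have hL : ∀ k : ℤ, (N : ℤ) ≤ |k| →
      dist x (h ^ i • x) + dist x (h ^ (k - i) • x) ≤ dist x (h ^ k • x) + 24 * C := fun k hk => by
    obtain ⟨z, hz, hyz⟩ := hfar k hk
    have h1 := hX.dist_add_dist_le hY hy' hz hyz
    have e1 : dist (g • x) (g • h ^ i • x) = dist x (h ^ i • x) := dist_smul _ _ _
    have e2 : dist (g • x) (g • h ^ k • x) = dist x (h ^ k • x) := dist_smul _ _ _
    have e3 : dist (g • h ^ i • x) (g • h ^ k • x) = dist x (h ^ (k - i) • x) := by
      rw [dist_smul, dist_zpow_smul_zpow_smul]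
    linarith [dist_triangle (g • x) y' (g • h ^ i • x),
      dist_triangle (g • h ^ i • x) y' (g • h ^ k • x), dist_comm y' (g • h ^ i • x)]
  have hLi : dist x (h ^ i • x) ≤ 24 * C := by
    by_contra! hlt
    -- With sign opposite to `i`, repeated subtraction of `i` moves away from `0`, so `hL` keeps
    -- applying; each step would lower a displacement by the same positive amount, forever.
    obtain ⟨k₀, hk₀⟩ : ∃ k₀ : ℤ, ∀ j : ℕ, (N : ℤ) ≤ |k₀ - j * i| := by
      rcases le_total 0 i with hi | hi
      · refine ⟨-N, fun j => ?_⟩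
        have := mul_nonneg (Int.natCast_nonneg j) hi
        rw [abs_of_nonpos (by omega)]
        omega
      · refine ⟨N, fun j => ?_⟩
        have := mul_nonpos_of_nonneg_of_nonpos (Int.natCast_nonneg j) hi
        rw [abs_of_nonneg (by omega)]
        omega
    have hind : ∀ j : ℕ, dist x (h ^ (k₀ - j * i) • x) ≤
        dist x (h ^ k₀ • x) - j * (dist x (h ^ i • x) - 24 * C) := by
      intro j
      induction j with
      | zero => simp
      | succ j ih =>
        have h1 := hL _ (hk₀ j)
        have e : k₀ - j * i - i = k₀ - (j + 1 : ℕ) * i := by push_cast; ring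
        rw [e] at h1
        push_cast at h1 ⊢
        linarith
    obtain ⟨j, hj⟩ := exists_nat_gt (dist x (h ^ k₀ • x) / (dist x (h ^ i • x) - 24 * C))
    rw [div_lt_iff₀ (by linarith)] at hj
    linarith [hind j, dist_nonneg (x := x) (y := h ^ (k₀ - j * i) • x)]
  rw [← hy'.2]
  have e1 : dist (g • x) (g • h ^ i • x) = dist x (h ^ i • x) := dist_smul _ _ _
  linarith [dist_triangle (g • x) (g • h ^ i • x) y', dist_comm y' (g • h ^ i • x)]

/-- A geodesic from `o` to a point whose projection is far from `o` begins near the set. -/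
theorem _root_.IsProximinalContracting.infDist_le_of_not_projectsNear {X : Set Y}
    (hY : IsGeodesicSpace Y) (hX : IsProximinalContracting C X) {o q : Y} {r T : ℝ}
    (hr : Metric.infDist o X ≤ r) (hr' : 2 * C ≤ r)
    (hq : ¬ ProjectsNear X o (T + r + 2 * C) q) (hT : 0 ≤ T) {γ : ℝ → Y}
    (hγ : IsGeodesicSegment γ o q) :
    T ≤ dist o q ∧ ∀ t ∈ Icc 0 T, Metric.infDist (γ t) X ≤ 2 * r + 8 * C := by
  simp only [ProjectsNear, not_forall, not_le] at hq
  obtain ⟨y, hy, hyo⟩ := hq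
  obtain ⟨o', ho'⟩ := hX.exists_nearest o
  have hC := hX.nonneg
  rw [← ho'.2] at hr
  obtain ⟨s, hs, hd⟩ := hX.exists_dist_le_right (x := o') (y := y) dist_nonneg hγ.1
    (by rwa [hγ.2.1]) (by rwa [hγ.2.2])
    (by linarith [dist_triangle o o' y, dist_comm o y])
  have e0 := hγ.1 0 ⟨le_rfl, dist_nonneg⟩ s hs
  rw [hγ.2.1, zero_sub, abs_neg, abs_of_nonneg hs.1] at e0
  have hTs : T ≤ s := by
    linarith [dist_triangle o (γ s) y, dist_comm o y]
  refine ⟨hTs.trans hs.2, fun t ht => ?_⟩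
  have hts : t ≤ s := ht.2.trans hTs
  have htd : t ∈ Icc 0 (dist o q) := ⟨ht.1, hts.trans hs.2⟩
  refine hX.infDist_le_of_between hY (p := o) (q := γ s) (by rwa [← ho'.2])
    (((Metric.infDist_le_dist_of_mem hy.1).trans hd).trans hr') ?_
  have e1 := hγ.1 0 ⟨le_rfl, dist_nonneg⟩ t htd
  rw [hγ.2.1, zero_sub, abs_neg, abs_of_nonneg ht.1] at e1
  have e2 := hγ.1 t htd s hs
  rw [abs_sub_comm, abs_of_nonneg (by linarith)] at e2
  linarith

variable [ProperSpace Y] [ProperlyDiscontinuousSMul G Y]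

/-- No point projects far from `o` on two independent axes. -/
theorem exists_projectsNear_or (hY : IsGeodesicSpace Y) (hh : IsContractingAxis C h x) {g₁ g₂ : G}
    (hg : g₁⁻¹ * g₂ ∉ commensuratingSubgroup h) (o : Y) :
    ∃ τ, ∀ q, ProjectsNear (g₁ • zpowersOrbit h x) o τ q ∨
      ProjectsNear (g₂ • zpowersOrbit h x) o τ q := by
  have hX := hh.contracting
  have hC := hX.nonneg
  have hX₁ := hX.smul g₁
  have hX₂ := hX.smul g₂
  set r := Metric.infDist o (g₁ • zpowersOrbit h x) +
    Metric.infDist o (g₂ • zpowersOrbit h x) + 2 * C with hrdef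
  have n₁ := Metric.infDist_nonneg (x := o) (s := g₁ • zpowersOrbit h x)
  have n₂ := Metric.infDist_nonneg (x := o) (s := g₂ • zpowersOrbit h x)
  set R := 2 * r + 8 * C with hR
  have hR0 : 0 ≤ R := by linarith
  have hF := finite_setOf_dist_smul_le (G := G) x x (2 * R)
  set F := hF.toFinset with hFdef
  -- Long enough for `F.card + 1` points spaced by `2R + 1`. A geodesic following both axes up to
  -- time `T` yields at each of them an element `h^(-n) g₁⁻¹ g₂ h^m` of `F`. Two of these coincide,
  -- hence have equal `n`, and the two points are both within `R` of one orbit point.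
  set T : ℝ := (2 * R + 1) * (F.card + 1) with hTdef
  refine ⟨T + r + 2 * C, fun q => ?_⟩
  by_contra! hcon
  obtain ⟨γ, hγ⟩ := hY o q
  have hT0 : 0 ≤ T := mul_nonneg (by linarith) (by exact_mod_cast Nat.zero_le (F.card + 1))
  obtain ⟨hTq, h₁⟩ := hX₁.infDist_le_of_not_projectsNear hY (by linarith) (by linarith) hcon.1 hT0 hγ
  obtain ⟨-, h₂⟩ := hX₂.infDist_le_of_not_projectsNear hY (by linarith) (by linarith) hcon.2 hT0 hγ
  have hpts : ∀ g : G, (∀ t ∈ Icc 0 T, Metric.infDist (γ t) (g • zpowersOrbit h x) ≤ R) →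
      ∀ t ∈ Icc 0 T, ∃ n : ℤ, dist (γ t) (g • h ^ n • x) ≤ R := fun g hg t ht => by
    obtain ⟨y, hy⟩ := (hX.smul g).exists_nearest (γ t)
    obtain ⟨n, rfl⟩ := mem_smul_zpowersOrbit.1 hy.1
    exact ⟨n, hy.2.trans_le (hg t ht)⟩
  choose! n hn using hpts g₁ h₁
  choose! m hm using hpts g₂ h₂
  set u : ℝ → G := fun t => h ^ (-n t) * (g₁⁻¹ * g₂) * h ^ m t with hu
  have hmem : ∀ l ∈ Finset.range (F.card + 1), (2 * R + 1) * (l : ℝ) ∈ Icc 0 T := fun l hl => by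
    have h1 : (l : ℝ) ≤ F.card + 1 := by exact_mod_cast (Finset.mem_range.1 hl).le
    exact ⟨mul_nonneg (by linarith) (Nat.cast_nonneg l), mul_le_mul_of_nonneg_left h1 (by linarith)⟩
  obtain ⟨l, hl, l', hl', hne, he⟩ := Finset.exists_ne_map_eq_of_card_lt_of_maps_to
    (s := Finset.range (F.card + 1)) (t := F) (by simp)
    (f := fun l => u ((2 * R + 1) * (l : ℝ))) (fun l hl => by
      have h1 := hn _ (hmem l hl)
      have h2 := hm _ (hmem l hl)
      set t := (2 * R + 1) * (l : ℝ)
      simp only [hFdef, Finite.coe_toFinset, mem_ofPred_eq, hu]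
      have e : dist x ((h ^ (-n t) * (g₁⁻¹ * g₂) * h ^ m t) • x) =
          dist (g₁ • h ^ n t • x) (g₂ • h ^ m t • x) := by
        rw [← dist_smul (h ^ (-n t) * g₁⁻¹) (g₁ • h ^ n t • x)]
        simp [smul_smul, mul_assoc]
      rw [e]
      linarith [dist_triangle (g₁ • h ^ n t • x) (γ t) (g₂ • h ^ m t • x),
        dist_comm (g₁ • h ^ n t • x) (γ t)])
  have hlt := hmem l hl
  have hlt' := hmem l' hl'
  have hsep : 2 * R < dist (γ ((2 * R + 1) * (l : ℝ))) (γ ((2 * R + 1) * (l' : ℝ))) := by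
    rw [hγ.1 _ ⟨hlt.1, hlt.2.trans hTq⟩ _ ⟨hlt'.1, hlt'.2.trans hTq⟩, ← mul_sub, abs_mul,
      abs_of_nonneg (by linarith)]
    have h1 : (1 : ℝ) ≤ |(l : ℝ) - l'| := by
      have : (1 : ℤ) ≤ |(l : ℤ) - l'| := Int.one_le_abs (by omega)
      exact_mod_cast this
    nlinarith
  set t := (2 * R + 1) * (l : ℝ)
  set t' := (2 * R + 1) * (l' : ℝ)
  have hnn : n t ≠ n t' := fun hnn => by
    have h1 := hn t hlt
    have h2 := hn t' hlt'
    rw [← hnn] at h2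
    linarith [dist_triangle (γ t) (g₁ • h ^ n t • x) (γ t'), dist_comm (g₁ • h ^ n t • x) (γ t')]
  have hinj := hh.mul_zpow_mul_injective hg (a₁ := (-n t, m t)) (a₂ := (-n t', m t')) he
  exact hnn (neg_injective (Prod.ext_iff.1 hinj).1)

/-- By `infDist_smul_le` and properness the commensurating subgroup is a union of finitely many
cosets of `⟨h⟩ ≅ ℤ`; finite index would make `⟨h⟩` of finite index in `G`. -/
theorem infinite_quotient (hY : IsGeodesicSpace Y) (hG : IsNonElementary G)
    (hh : IsContractingAxis C h x) : Infinite (G ⧸ commensuratingSubgroup h) := by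
  rw [← not_finite_iff_infinite]
  intro hfin
  set H := (zpowersHom G h).range with hH
  have hmemH : ∀ n : ℤ, h ^ n ∈ H := fun n => ⟨Multiplicative.ofAdd n, rfl⟩
  have hinj : Function.Injective (zpowersHom G h) := fun a b hab => hh.zpow_injective hab
  have hF : {u : G | dist x (u • x) ≤ 34 * C}.Finite := finite_setOf_dist_smul_le x x _
  have : Finite {u : G | dist x (u • x) ≤ 34 * C} := hF
  have hsurj : Function.Surjective
      fun q : (G ⧸ commensuratingSubgroup h) × {u : G | dist x (u • x) ≤ 34 * C} =>
        (QuotientGroup.mk (q.1.out * (q.2 : G)⁻¹) : G ⧸ H) := by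
    intro z
    obtain ⟨z, rfl⟩ := QuotientGroup.mk_surjective z
    have he : (QuotientGroup.mk z : G ⧸ commensuratingSubgroup h).out⁻¹ * z ∈
        commensuratingSubgroup h := QuotientGroup.eq.1 (Quotient.out_eq' _)
    set t := (QuotientGroup.mk z : G ⧸ commensuratingSubgroup h).out
    have hd := hh.infDist_smul_le hY (inv_mem he)
    obtain ⟨y, hy⟩ := hh.contracting.exists_nearest ((t⁻¹ * z)⁻¹ • x)
    obtain ⟨n, rfl⟩ := hy.1
    rw [← hy.2] at hd
    refine ⟨⟨QuotientGroup.mk z, ⟨h ^ (-n) * (t⁻¹ * z)⁻¹, ?_⟩⟩, QuotientGroup.eq.2 ?_⟩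
    · rw [mem_ofPred_eq, dist_comm, ← dist_smul (h ^ n)]
      simpa [smul_smul, ← mul_assoc] using hd
    · convert hmemH (-n) using 1
      simp only [t]
      group
  have : Finite (G ⧸ H) := Finite.of_surjective _ hsurj
  exact (hG H Subgroup.finiteIndex_of_finite_quotient).2
    ⟨(MonoidHom.ofInjective hinj).symm⟩

/-- There are three translates of the axis such that every point projects near `o` on at least two
of them. -/
theorem exists_three_axes (hY : IsGeodesicSpace Y) (hG : IsNonElementary G)
    (hh : IsContractingAxis C h x) (o : Y) :
    ∃ (g : Fin 3 → G) (τ : ℝ), ∀ i j, i ≠ j → ∀ q,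
      ProjectsNear (g i • zpowersOrbit h x) o τ q ∨ ProjectsNear (g j • zpowersOrbit h x) o τ q := by
  have := hh.infinite_quotient hY hG
  set e := Infinite.natEmbedding (G ⧸ commensuratingSubgroup h)
  set g : Fin 3 → G := fun i => (e i).out
  have hg : ∀ i j, i ≠ j → (g i)⁻¹ * g j ∉ commensuratingSubgroup h := fun i j hij hmem => by
    have h1 := QuotientGroup.eq.2 hmem
    simp only [g, QuotientGroup.out_eq'] at h1
    exact hij (Fin.ext (e.injective h1))
  have hτ : ∀ i j, ∃ τ, i ≠ j → ∀ q, ProjectsNear (g i • zpowersOrbit h x) o τ q ∨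
      ProjectsNear (g j • zpowersOrbit h x) o τ q := fun i j => by
    by_cases hij : i = j
    · exact ⟨0, fun hne => absurd hij hne⟩
    · obtain ⟨τ, hτ⟩ := hh.exists_projectsNear_or hY (hg i j hij) o
      exact ⟨τ, fun _ => hτ⟩
  choose τ hτ using hτ
  refine ⟨g, ∑ i, ∑ j, |τ i j|, fun i j hij q => ?_⟩
  have hle : τ i j ≤ ∑ i, ∑ j, |τ i j| :=
    (le_abs_self _).trans ((Finset.single_le_sum (f := fun j => |τ i j|)
      (fun _ _ => abs_nonneg _) (Finset.mem_univ j)).trans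
      (Finset.single_le_sum (f := fun i => ∑ j, |τ i j|)
      (fun _ _ => Finset.sum_nonneg fun _ _ => abs_nonneg _) (Finset.mem_univ i)))
  exact (hτ i j hij q).imp (fun h => h.mono hle) (fun h => h.mono hle)

end IsContractingAxis
end Contracting

/-! ### Critical exponents -/

section Growth

theorem exists_forall_add_mul_le_exp (K L : ℝ) {c : ℝ} (hc : 0 < c) :
    ∃ N : ℕ, ∀ x : ℝ, N ≤ x → K + L * x ≤ Real.exp (c * x) := by
  obtain ⟨N, hN⟩ := exists_nat_gt (2 * (|K| + |L|) / c ^ 2 + 1)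
  refine ⟨N, fun x hx => ?_⟩
  have hx1 : 2 * (|K| + |L|) / c ^ 2 + 1 ≤ x := hN.le.trans hx
  have h0 : 0 ≤ 2 * (|K| + |L|) / c ^ 2 := by positivity
  have h1 : 2 * (|K| + |L|) ≤ x * c ^ 2 := by
    rw [← div_le_iff₀ (by positivity)]; linarith
  have h2 := Real.quadratic_le_exp_of_nonneg (show 0 ≤ c * x by
    have : 0 ≤ x := by linarith
    positivity)
  have hx0 : 1 ≤ x := by linarith
  have h3 : K ≤ |K| * x := (le_abs_self K).trans (le_mul_of_one_le_right (abs_nonneg K) hx0)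
  have h4 : L * x ≤ |L| * x := mul_le_mul_of_nonneg_right (le_abs_self L) (by linarith)
  have h5 : 2 * (|K| + |L|) * x ≤ x * c ^ 2 * x := mul_le_mul_of_nonneg_right h1 (by linarith)
  have h6 : 0 ≤ c * x := by positivity
  nlinarith

theorem coe_le_log_encard_div_iff {α : Type*} {s : Set α} (hs : s.Finite) {n : ℕ} (hn : 0 < n) (a : ℝ) :
    (a : EReal) ≤ ENNReal.log (s.encard : ENNReal) / (n : EReal) ↔
      Real.exp (a * n) ≤ s.ncard := by
  rw [EReal.le_div_iff_mul_le (by exact_mod_cast hn) (EReal.natCast_ne_top n),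
    ← hs.cast_ncard_eq, show (a : EReal) * (n : EReal) = ((a * n : ℝ) : EReal) by
      rw [EReal.coe_mul]; rfl, ← EReal.log_exp ((a * n : ℝ) : EReal),
    ENNReal.log_strictMono.le_iff_le, EReal.exp_coe]
  simp

theorem log_encard_div_le_coe_iff {α : Type*} {s : Set α} (hs : s.Finite) {n : ℕ} (hn : 0 < n) (a : ℝ) :
    ENNReal.log (s.encard : ENNReal) / (n : EReal) ≤ a ↔ (s.ncard : ℝ) ≤ Real.exp (a * n) := by
  rw [EReal.div_le_iff_le_mul (by exact_mod_cast hn) (EReal.natCast_ne_top n),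
    ← hs.cast_ncard_eq, show (n : EReal) * (a : EReal) = ((a * n : ℝ) : EReal) by
      rw [mul_comm, EReal.coe_mul]; rfl, ← EReal.log_exp ((a * n : ℝ) : EReal),
    ENNReal.log_strictMono.le_iff_le, EReal.exp_coe]
  rw [show ((s.ncard : ℕ∞) : ENNReal) = ENNReal.ofReal s.ncard by simp,
    ENNReal.ofReal_le_ofReal_iff (Real.exp_pos _).le]

variable {G Y : Type*} [Group G] [MetricSpace Y] [MulAction G Y]

theorem criticalExponent_mono (o : Y) {Γ Γ' : Set G} (h : Γ ⊆ Γ') :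
    criticalExponent o Γ ≤ criticalExponent o Γ' := by
  refine limsup_le_limsup (Eventually.of_forall fun n => ?_)
  refine EReal.div_le_div_right_of_nonneg (by positivity) (ENNReal.log_monotone ?_)
  exact_mod_cast encard_le_encard (inter_subset_inter_right _ h)

variable [ProperSpace Y] [ProperlyDiscontinuousSMul G Y]

theorem finite_orbitBall_inter (o : Y) (r : ℝ) (Γ : Set G) :
    (orbitBall o r ∩ Γ : Set G).Finite :=
  (finite_setOf_dist_smul_le o o r).subset inter_subset_left

theorem le_criticalExponent {o : Y} {Γ : Set G} {a : ℝ}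
    (h : ∀ N : ℕ, ∃ n ≥ N, 0 < n ∧
      Real.exp (a * n) ≤ (orbitBall o (n : ℝ) ∩ Γ : Set G).ncard) :
    (a : EReal) ≤ criticalExponent o Γ := by
  refine le_limsup_of_frequently_le' (frequently_atTop.2 fun N => ?_)
  obtain ⟨n, hn, hn0, hle⟩ := h N
  exact ⟨n, hn, (coe_le_log_encard_div_iff (finite_orbitBall_inter o n Γ) hn0 a).2 hle⟩

theorem criticalExponent_le {o : Y} {Γ : Set G} {a : ℝ}
    (h : ∃ N : ℕ, ∀ n ≥ N, ((orbitBall o (n : ℝ) ∩ Γ : Set G).ncard : ℝ) ≤ Real.exp (a * n)) :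
    criticalExponent o Γ ≤ a := by
  obtain ⟨N, hN⟩ := h
  refine limsup_le_of_le (by isBoundedDefault) ?_
  filter_upwards [eventually_ge_atTop N, eventually_gt_atTop 0] with n hn hn0
  exact (log_encard_div_le_coe_iff (finite_orbitBall_inter o n Γ) hn0 a).2 (hN n hn)

variable (G) in
/-- The elements of `G` that move `o` by a distance in `(m, m + 1]`. -/
def orbitAnnulus (o : Y) (m : ℕ) : Set G :=
  {g : G | (m : ℝ) < dist o (g • o) ∧ dist o (g • o) ≤ m + 1}

variable (G)

theorem finite_orbitAnnulus (o : Y) (m : ℕ) : (orbitAnnulus G o m).Finite :=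
  (finite_setOf_dist_smul_le o o _).subset fun _ hg => hg.2

theorem ncard_orbitBall_le (o : Y) {m n : ℕ} (hmn : m ≤ n) {B : ℝ}
    (hB : ∀ k, m ≤ k → k < n → ((orbitAnnulus G o k).ncard : ℝ) ≤ B) :
    ((orbitBall o (n : ℝ) ∩ univ : Set G).ncard : ℝ) ≤
      (orbitBall o (m : ℝ) ∩ univ : Set G).ncard + (n - m) * B := by
  induction n, hmn using Nat.le_induction with
  | base => simp
  | succ n hmn ih =>
    have h1 := ih fun k hk hkn => hB k hk (hkn.trans (Nat.lt_succ_self n))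
    have h2 := hB n hmn (Nat.lt_succ_self n)
    have hsub : (orbitBall o ((n + 1 : ℕ) : ℝ) ∩ univ : Set G) ⊆
        (orbitBall o (n : ℝ) ∩ univ) ∪ orbitAnnulus G o n := by
      rintro g ⟨hg, -⟩
      rcases le_or_gt (dist o (g • o)) n with h | h
      · exact Or.inl ⟨h, mem_univ g⟩
      · exact Or.inr ⟨h, by simpa [orbitBall] using hg⟩
    have h3 := (ncard_le_ncard hsub
      ((finite_orbitBall_inter o _ _).union (finite_orbitAnnulus G o n))).trans
      (ncard_union_le _ _)
    have h4 : ((orbitBall o ((n + 1 : ℕ) : ℝ) ∩ univ : Set G).ncard : ℝ) ≤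
        (orbitBall o (n : ℝ) ∩ univ : Set G).ncard + (orbitAnnulus G o n).ncard := by
      exact_mod_cast h3
    push_cast at h4 ⊢
    linarith

/-- Annuli contain exponentially many elements. -/
theorem exists_exp_lt_ncard_orbitAnnulus (o : Y) {a : ℝ} (ha : 0 < a)
    (h : (a : EReal) < criticalExponent o (univ : Set G)) (N : ℕ) :
    ∃ m ≥ N, Real.exp (a * m) < (orbitAnnulus G o m).ncard := by
  by_contra! hcon
  obtain ⟨b, hab, hb⟩ := EReal.lt_iff_exists_real_btwn.1 h
  have hab : a < b := by exact_mod_cast hab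
  refine absurd (criticalExponent_le ?_) (not_le.2 hb)
  set K : ℝ := ((orbitBall o (N : ℝ) ∩ univ : Set G).ncard : ℝ) with hK
  -- The gap between `a` and `b` absorbs the factor `K + n` coming from summing over annuli.
  obtain ⟨N', hN'⟩ := exists_forall_add_mul_le_exp K 1 (sub_pos.2 hab)
  refine ⟨max N N', fun n hn => ?_⟩
  have hNn : N ≤ n := (le_max_left _ _).trans hn
  have h1 := ncard_orbitBall_le G o hNn (B := Real.exp (a * n)) fun k hk hkn =>
    (hcon k hk).trans (Real.exp_le_exp.2 (by gcongr))
  have h2 := hN' n (by exact_mod_cast (le_max_right _ _).trans hn)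
  have h3 : 1 ≤ Real.exp (a * n) := Real.one_le_exp (by positivity)
  have h4 : Real.exp (b * n) = Real.exp ((b - a) * n) * Real.exp (a * n) := by
    rw [← Real.exp_add]; congr 1; ring
  have hK0 : 0 ≤ K := Nat.cast_nonneg _
  have hN0 : (0 : ℝ) ≤ N := Nat.cast_nonneg _
  calc _ ≤ K + (n - N) * Real.exp (a * n) := h1
    _ ≤ K * Real.exp (a * n) + n * Real.exp (a * n) := by
      have := le_mul_of_one_le_right hK0 h3
      have := mul_nonneg hN0 (Real.exp_pos (a * n)).le
      linarith
    _ = (K + 1 * n) * Real.exp (a * n) := by ring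
    _ ≤ _ := by
      rw [h4]
      exact mul_le_mul_of_nonneg_right h2 (Real.exp_pos _).le

variable {G}

/-- Annuli contain arbitrarily many elements. -/
theorem IsContractingAxis.exists_lt_ncard_orbitAnnulus [IsIsometricSMul G Y] {C : ℝ} {h : G} {x : Y}
    (hh : IsContractingAxis C h x) {g : G} (hg : g ∉ commensuratingSubgroup h) (o : Y)
    (B N : ℕ) : ∃ m ≥ N, B < (orbitAnnulus G o m).ncard := by
  by_contra! hcon
  set K : ℝ := ((orbitBall o (N : ℝ) ∩ univ : Set G).ncard : ℝ) with hK
  set L : ℕ := ⌈dist o (h • o)⌉₊ with hL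
  set D : ℕ := ⌈dist o (g • o)⌉₊ with hD
  have hball : ∀ n : ℕ, ((orbitBall o (n : ℝ) ∩ univ : Set G).ncard : ℝ) ≤ K + n * B := by
    intro n
    have hB0 : (0 : ℝ) ≤ B := Nat.cast_nonneg B
    have hn0 : (0 : ℝ) ≤ n := Nat.cast_nonneg n
    rcases le_total N n with hNn | hNn
    · have h1 := ncard_orbitBall_le G o hNn (B := B) fun k hk _ => by exact_mod_cast hcon k hk
      have h2 : (0 : ℝ) ≤ N := Nat.cast_nonneg N
      nlinarith
    · have h1 : (orbitBall o (n : ℝ) ∩ univ : Set G).ncard ≤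
          (orbitBall o (N : ℝ) ∩ univ : Set G).ncard :=
        ncard_le_ncard (fun u hu => ⟨(show dist o (u • o) ≤ n from hu.1).trans
          (by exact_mod_cast hNn), hu.2⟩)
          (finite_orbitBall_inter o _ _)
      have h2 : ((orbitBall o (n : ℝ) ∩ univ : Set G).ncard : ℝ) ≤ K := by rw [hK]; exact_mod_cast h1
      nlinarith
  have hpow : ∀ i : ℕ, dist o (h ^ i • o) ≤ i * L := by
    intro i
    induction i with
    | zero => simp
    | succ i ih =>
      have h1 := dist_triangle o (h ^ i • o) (h ^ (i + 1) • o)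
      rw [pow_succ, mul_smul, dist_smul] at h1
      rw [pow_succ, mul_smul]
      push_cast
      linarith [Nat.le_ceil (dist o (h • o))]
  -- Bounded annuli would force linear growth, whereas the `k²` distinct elements `h^i g h^j` lie in
  -- a ball of radius linear in `k`.
  have hquad : ∀ k : ℕ, ((k : ℝ)) ^ 2 ≤ K + (2 * k * L + D : ℕ) * B := by
    intro k
    refine le_trans ?_ (hball _)
    have himg : ((Finset.range k ×ˢ Finset.range k : Finset (ℕ × ℕ)) : Set (ℕ × ℕ)).ncard ≤
        (orbitBall o ((2 * k * L + D : ℕ) : ℝ) ∩ univ : Set G).ncard := by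
      refine ncard_le_ncard_of_injOn (fun p => h ^ p.1 * g * h ^ p.2) ?_ ?_
        (finite_orbitBall_inter o _ _)
      · rintro ⟨i, j⟩ hij
        simp only [Finset.coe_product, mem_prod, Finset.coe_range, mem_Iio] at hij
        refine ⟨?_, mem_univ _⟩
        have h1 : dist o ((h ^ i * g * h ^ j) • o) ≤
            dist o (h ^ i • o) + dist o (g • o) + dist o (h ^ j • o) := by
          have := dist_triangle4 o (h ^ i • o) (h ^ i • g • o) (h ^ i • g • h ^ j • o)
          simpa [mul_smul] using this
        have h2 := hpow i
        have h3 := hpow j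
        have h4 : (i : ℝ) * L ≤ k * L := by
          have : (i : ℝ) ≤ k := by exact_mod_cast hij.1.le
          gcongr
        have h5 : (j : ℝ) * L ≤ k * L := by
          have : (j : ℝ) ≤ k := by exact_mod_cast hij.2.le
          gcongr
        show dist o ((h ^ i * g * h ^ j) • o) ≤ _
        push_cast
        linarith [Nat.le_ceil (dist o (g • o))]
      · rintro ⟨i, j⟩ - ⟨i', j'⟩ - he
        have := hh.mul_zpow_mul_injective hg (a₁ := ((i : ℤ), (j : ℤ))) (a₂ := ((i' : ℤ), (j' : ℤ)))
          (by simpa using he)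
        simpa using this
    rw [ncard_coe_finset, Finset.card_product, Finset.card_range] at himg
    rw [sq]
    exact_mod_cast himg
  obtain ⟨k, hk⟩ := exists_nat_gt (K + D * B + 2 * L * B + 1)
  have h1 := hquad k
  push_cast at h1
  have hK0 : 0 ≤ K := Nat.cast_nonneg _
  have p1 : (0 : ℝ) ≤ D * B := by positivity
  have p2 : (0 : ℝ) ≤ 2 * L * B := by positivity
  have hk1 : (1 : ℝ) ≤ k := by linarith
  nlinarith

end Growth

/-! ### The growth of the free semigroups -/

section SemigroupGrowth

variable {G Y : Type*} [Group G] [MetricSpace Y] [ProperSpace Y] [MulAction G Y]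
  [IsIsometricSMul G Y] [ProperlyDiscontinuousSMul G Y]

namespace IsPingPong

variable {o : Y} {C τ ℓ : ℝ} {X : Set Y} {f : G}

theorem le_criticalExponent (hY : IsGeodesicSpace Y) {A : Finset G}
    (h : IsPingPong o C τ ℓ X f (A : Set G)) {a : ℝ} {M : ℕ}
    (hM : ℓ + 1 + dist o (f • o) ≤ M) (ha : Real.exp (a * M) ≤ A.card) :
    (a : EReal) ≤ criticalExponent o
      (Subsemigroup.closure (altGenerators f (A : Set G)) : Set G) := by
  have hM0 : 0 < M := by
    have : (0 : ℝ) < M := by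
      linarith [h.large, h.nonneg, h.contracting.nonneg, dist_nonneg (x := o) (y := f • o)]
    exact_mod_cast this
  refine _root_.le_criticalExponent fun N => ?_
  refine ⟨(N + 1) * M, by nlinarith, by positivity, ?_⟩
  set k := N + 1
  have h1 : Real.exp (a * (k * M : ℕ)) ≤ (A.card ^ k : ℕ) := by
    push_cast
    rw [show a * (k * M) = k * (a * M) by ring, Real.exp_nat_mul]
    exact pow_le_pow_left₀ (Real.exp_pos _).le ha k
  refine h1.trans (Nat.cast_le.2 ?_)
  have hw : ∀ v : Fin k → A, ∀ c ∈ List.ofFn fun i => (v i : G), c ∈ (A : Set G) := by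
    intro v c hc
    obtain ⟨i, rfl⟩ := (List.mem_ofFn' _ _).1 hc
    exact (v i).2
  have hinj : Function.Injective fun v : Fin k → A => altProd f (List.ofFn fun i => (v i : G)) := by
    intro v v' he
    have := List.ofFn_injective (h.altProd_injOn hY (hw v) (hw v') he)
    funext i
    exact Subtype.ext (congrFun this i)
  have hcard : (range fun v : Fin k → A => altProd f (List.ofFn fun i => (v i : G))).ncard =
      A.card ^ k := by
    rw [← image_univ, ncard_image_of_injective _ hinj, ncard_univ]
    simp
  rw [← hcard]
  refine ncard_le_ncard ?_ (finite_orbitBall_inter o _ _)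
  rintro _ ⟨v, rfl⟩
  refine ⟨?_, mem_closure_altGenerators.2 ⟨_, ?_, hw v, rfl⟩⟩
  · refine (h.dist_altProd_le (hw v)).trans ?_
    rw [List.length_ofFn]
    push_cast
    gcongr
  · simp [k]

/-- An element of the `n`-ball is a word of length at most `n / δ`, so there are at most `(k + 1)
|A|^k` of them with `k = ⌊n / δ⌋`; the linear factor is absorbed since `log |A| / δ < a`. -/
theorem criticalExponent_le (hY : IsGeodesicSpace Y) {A : Finset G} (hA : A.Nonempty)
    (h : IsPingPong o C τ ℓ X f (A : Set G)) {a : ℝ}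
    (ha : Real.log A.card < a * (ℓ - (2 * τ + 6 * C))) :
    criticalExponent o (Subsemigroup.closure (altGenerators f (A : Set G)) : Set G) ≤ a := by
  classical
  set δ := ℓ - (2 * τ + 6 * C) with hδ
  have hδ0 : 0 < δ := by linarith [h.large]
  have hs1 : (1 : ℝ) ≤ A.card := by exact_mod_cast hA.card_pos
  set s : ℝ := (A.card : ℝ) with hs
  have hc : 0 < a - Real.log s / δ := by
    rw [sub_pos, div_lt_iff₀ hδ0]; exact ha
  obtain ⟨N, hN⟩ := exists_forall_add_mul_le_exp 1 (1 / δ) hc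
  refine _root_.criticalExponent_le ⟨N, fun n hn => ?_⟩
  set k := ⌊(n : ℝ) / δ⌋₊ with hk
  have hkn : (k : ℝ) ≤ n / δ := Nat.floor_le (by positivity)
  let W : ℕ → Finset G := fun i =>
    Finset.univ.image fun v : Fin i → A => altProd f (List.ofFn fun j => (v j : G))
  have hsub : (orbitBall o (n : ℝ) ∩ (Subsemigroup.closure (altGenerators f (A : Set G)) : Set G)) ⊆
      ((Finset.range (k + 1)).biUnion W : Finset G) := by
    rintro g ⟨hg, hgΓ⟩
    obtain ⟨l, -, hl, rfl⟩ := mem_closure_altGenerators.1 hgΓ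
    have h1 := (h.le_dist_altProd hY hl).trans hg
    have h2 : l.length ≤ k := Nat.le_floor (by rwa [le_div_iff₀ hδ0])
    simp only [Finset.coe_biUnion, mem_iUnion, Finset.mem_coe, Finset.mem_range, W,
      Finset.mem_image, Finset.mem_univ, true_and]
    exact ⟨l.length, by omega, fun j => ⟨l.get j, hl _ (List.get_mem _ _)⟩, by simp⟩
  have hcard : ((orbitBall o (n : ℝ) ∩
      (Subsemigroup.closure (altGenerators f (A : Set G)) : Set G) : Set G).ncard : ℝ) ≤
      (k + 1) * s ^ k := by
    have h1 := ncard_le_ncard hsub (Finset.finite_toSet _)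
    rw [ncard_coe_finset] at h1
    have h2 : ((Finset.range (k + 1)).biUnion W).card ≤ (k + 1) * A.card ^ k := by
      refine (Finset.card_biUnion_le_card_mul _ _ (A.card ^ k) fun i hi => ?_).trans (by simp)
      refine Finset.card_image_le.trans ?_
      rw [Finset.card_univ, Fintype.card_fun, Fintype.card_coe, Fintype.card_fin]
      exact Nat.pow_le_pow_right hA.card_pos (by
        have := Finset.mem_range.1 hi; omega)
    rw [hs]
    exact_mod_cast h1.trans h2
  have hpow : s ^ k ≤ Real.exp (Real.log s / δ * n) := by
    rw [← Real.exp_log (show 0 < s by linarith), ← Real.exp_nat_mul, Real.exp_log (by linarith)]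
    refine Real.exp_le_exp.2 ?_
    have := mul_le_mul_of_nonneg_right hkn (Real.log_nonneg hs1)
    refine this.trans (le_of_eq ?_)
    ring
  have hlin := hN n (by exact_mod_cast hn)
  calc _ ≤ (k + 1) * s ^ k := hcard
    _ ≤ (1 + 1 / δ * n) * Real.exp (Real.log s / δ * n) := by
      have : 1 / δ * n = n / δ := by ring
      exact mul_le_mul (by linarith) hpow (by positivity) (by positivity)
    _ ≤ Real.exp ((a - Real.log s / δ) * n) * Real.exp (Real.log s / δ * n) :=
      mul_le_mul_of_nonneg_right hlin (Real.exp_pos _).le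
    _ = _ := by rw [← Real.exp_add]; congr 1; ring

end IsPingPong
end SemigroupGrowth

/-! ### Construction of large free semigroups -/

section Construction

variable {G Y : Type*} [Group G] [MetricSpace Y] [ProperSpace Y] [MulAction G Y]
  [IsIsometricSMul G Y] [ProperlyDiscontinuousSMul G Y]

open scoped Pointwise

/-- A greedy choice: each chosen `a` discards only elements of `a` times the `R`-ball, which is
finite by properness. -/
theorem exists_separated_subset (o : Y) {R : ℝ} (hR : 0 ≤ R) (A : Finset G) : ∃ B ⊆ A,
    A.card ≤ {g : G | dist o (g • o) ≤ R}.ncard * B.card ∧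
      ∀ a ∈ B, ∀ b ∈ B, a ≠ b → R < dist (a • o) (b • o) := by
  classical
  induction A using Finset.strongInduction with
  | H A ih =>
    rcases A.eq_empty_or_nonempty with rfl | ⟨a, ha⟩
    · exact ⟨∅, le_rfl, by simp, by simp⟩
    · set A' := A.filter fun b => R < dist (a • o) (b • o) with hA'
      have hlt : A' ∪ (A.filter fun b => ¬ R < dist (a • o) (b • o)) = A :=
        Finset.filter_union_filter_not_eq _ _
      have hfin : {g : G | dist o (g • o) ≤ R}.Finite := finite_setOf_dist_smul_le o o R
      have hcard : (A.filter fun b => ¬ R < dist (a • o) (b • o)).card ≤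
          {g : G | dist o (g • o) ≤ R}.ncard := by
        rw [← ncard_coe_finset]
        refine ncard_le_ncard_of_injOn (fun b => a⁻¹ * b) ?_
          (fun b _ b' _ hbb => mul_left_cancel hbb) hfin
        intro b hb
        have hb := (Finset.mem_filter.1 hb).2
        rw [mem_ofPred_eq, ← dist_smul a, smul_smul, mul_inv_cancel_left]
        exact not_lt.1 hb
      have haA' : a ∉ A' := fun h => by
        have := (Finset.mem_filter.1 h).2
        rw [dist_self] at this
        linarith
      obtain ⟨B, hB, hBc, hBs⟩ := ih A' ((Finset.filter_subset _ _).ssubset_of_ne fun h =>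
        haA' (by rw [hA', h]; exact ha))
      have haB : a ∉ B := fun h => haA' (hB h)
      refine ⟨insert a B, Finset.insert_subset ha (hB.trans (Finset.filter_subset _ _)), ?_, ?_⟩
      · rw [Finset.card_insert_of_notMem haB, mul_add, mul_one]
        calc A.card ≤ A'.card + _ := by
              conv_lhs => rw [← hlt]
              exact Finset.card_union_le _ _
          _ ≤ _ := add_le_add hBc hcard
      · intro b hb c hc hbc
        rcases Finset.mem_insert.1 hb with rfl | hb' <;> rcases Finset.mem_insert.1 hc with rfl | hc'
        · exact absurd rfl hbc
        · exact (Finset.mem_filter.1 (hB hc')).2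
        · rw [dist_comm]
          exact (Finset.mem_filter.1 (hB hb')).2
        · exact hBs b hb' c hc' hbc

/-- A fixed proportion of any set of elements in a distant annulus plays ping-pong. -/
theorem IsContractingAxis.exists_isPingPong (hY : IsGeodesicSpace Y) (hG : IsNonElementary G)
    {C : ℝ} {h : G} {x : Y} (hh : IsContractingAxis C h x) (o : Y) :
    ∃ (τ L : ℝ) (K : ℕ), ∀ m : ℕ, 2 * τ + 6 * C < m → ∀ A : Finset G,
      (A : Set G) ⊆ orbitAnnulus G o m → ∃ (X : Set Y) (f : G) (B : Finset G), B ⊆ A ∧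
        A.card ≤ K * B.card ∧ dist o (f • o) ≤ L ∧ IsPingPong o C τ m X f (B : Set G) := by
  classical
  have hX := hh.contracting
  obtain ⟨g, τ₀, hτ₀⟩ := hh.exists_three_axes hY hG o
  set τ : ℝ := |τ₀| + ∑ i, Metric.infDist o (g i • zpowersOrbit h x) with hτ
  have hinf : ∀ i, Metric.infDist o (g i • zpowersOrbit h x) ≤
      ∑ i, Metric.infDist o (g i • zpowersOrbit h x) := fun i =>
    Finset.single_le_sum (f := fun i => Metric.infDist o (g i • zpowersOrbit h x))
      (fun _ _ => Metric.infDist_nonneg) (Finset.mem_univ i)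
  have hτle : τ₀ ≤ τ := by
    linarith [le_abs_self τ₀, hinf 0, Metric.infDist_nonneg (x := o) (s := g 0 • zpowersOrbit h x)]
  have hτ0 : 0 ≤ τ := by
    linarith [abs_nonneg τ₀, hinf 0,
      Metric.infDist_nonneg (x := o) (s := g 0 • zpowersOrbit h x)]
  obtain ⟨N, hN⟩ := hh.exists_lt_dist (2 * τ + 7 * C + 2 * ∑ i, dist x ((g i)⁻¹ • o))
  set f : Fin 3 → G := fun i => g i * h ^ (N : ℤ) * (g i)⁻¹ with hf
  have hlong : ∀ i, 2 * τ + 7 * C < dist o (f i • o) := fun i => by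
    have h1 := hN N (by simp)
    have h2 : dist x ((g i)⁻¹ • o) ≤ ∑ i, dist x ((g i)⁻¹ • o) :=
      Finset.single_le_sum (f := fun i => dist x ((g i)⁻¹ • o)) (fun _ _ => dist_nonneg)
        (Finset.mem_univ i)
    have e : dist o (f i • o) = dist ((g i)⁻¹ • o) (h ^ (N : ℤ) • (g i)⁻¹ • o) := by
      rw [← dist_smul (g i)⁻¹ o]
      simp [hf, smul_smul, mul_assoc]
    have e2 : dist (h ^ (N : ℤ) • (g i)⁻¹ • o) (h ^ (N : ℤ) • x) = dist ((g i)⁻¹ • o) x :=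
      dist_smul _ _ _
    rw [e]
    linarith [dist_triangle4 x ((g i)⁻¹ • o) (h ^ (N : ℤ) • (g i)⁻¹ • o) (h ^ (N : ℤ) • x),
      dist_comm x ((g i)⁻¹ • o)]
  -- The ball is the price of separating the orbit, the factor `3` that of a common axis.
  refine ⟨τ, ∑ i, dist o (f i • o), 3 * {u : G | dist o (u • o) ≤ 8 * C + 4 * τ + 1}.ncard,
    fun m hm A hA => ?_⟩
  obtain ⟨A', hA'A, hcard, hsep⟩ := exists_separated_subset o
    (R := 8 * C + 4 * τ + 1) (by linarith [hX.nonneg, hτ0]) A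
  -- Each of `a • o` and `a⁻¹ • o` rules out at most one of the three axes.
  have hi : ∀ a : G, ∃ i : Fin 3, ProjectsNear (g i • zpowersOrbit h x) o τ (a • o) ∧
      ProjectsNear (g i • zpowersOrbit h x) o τ (a⁻¹ • o) := by
    intro a
    have key : ∀ i j, i ≠ j → ∀ q, ProjectsNear (g i • zpowersOrbit h x) o τ q ∨
        ProjectsNear (g j • zpowersOrbit h x) o τ q := fun i j hij q =>
      (hτ₀ i j hij q).imp (fun h => h.mono hτle) (fun h => h.mono hτle)
    by_contra! hcon
    have c0 := hcon 0
    have c1 := hcon 1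
    have c2 := hcon 2
    have := key 0 1 (by decide) (a • o)
    have := key 0 2 (by decide) (a • o)
    have := key 1 2 (by decide) (a • o)
    have := key 0 1 (by decide) (a⁻¹ • o)
    have := key 0 2 (by decide) (a⁻¹ • o)
    have := key 1 2 (by decide) (a⁻¹ • o)
    tauto
  choose i hi1 hi2 using hi
  obtain ⟨j, hj⟩ : ∃ j : Fin 3, A'.card ≤ 3 * (A'.filter fun a => i a = j).card := by
    by_contra! hcon
    have h1 := Finset.card_eq_sum_card_fiberwise (f := i) (s := A') (t := Finset.univ)
      (fun a _ => Finset.mem_coe.2 (Finset.mem_univ _))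
    rw [Fin.sum_univ_three] at h1
    have c0 := hcon 0
    have c1 := hcon 1
    have c2 := hcon 2
    omega
  have hmem : ∀ a ∈ (A'.filter fun a => i a = j : Finset G), a ∈ A' ∧ i a = j := fun a ha =>
    Finset.mem_filter.1 ha
  refine ⟨g j • zpowersOrbit h x, f j, A'.filter fun a => i a = j,
    (Finset.filter_subset _ _).trans hA'A, ?_, ?_, ?_⟩
  · calc A.card ≤ _ := hcard
      _ ≤ {u : G | dist o (u • o) ≤ 8 * C + 4 * τ + 1}.ncard *
          (3 * (A'.filter fun a => i a = j).card) := Nat.mul_le_mul_left _ hj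
      _ = _ := by ring
  · exact Finset.single_le_sum (f := fun i => dist o (f i • o)) (fun _ _ => dist_nonneg)
      (Finset.mem_univ j)
  · refine ⟨hX.smul (g j), ?_, ?_, ?_, ?_, hlong j, hm, ?_, ?_, ?_⟩
    · rw [hf, smul_smul, inv_mul_cancel_right, mul_smul, smul_zpowersOrbit_self]
    · intro y hy
      rw [dist_comm, hy.2]
      linarith [hinf j, abs_nonneg τ₀]
    · intro a ha
      have := hi1 a
      rwa [(hmem a ha).2] at this
    · intro a ha
      have := hi2 a
      rwa [(hmem a ha).2] at this
    · exact fun a ha => (hA (hA'A (hmem a ha).1)).1.le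
    · exact fun a ha => (hA (hA'A (hmem a ha).1)).2
    · exact fun a ha b hb hab => hsep a (hmem a ha).1 b (hmem b hb).1 hab

/-- The critical exponent of a non-elementary group with a contracting element is positive. -/
theorem IsContractingAxis.criticalExponent_pos (hY : IsGeodesicSpace Y) (hG : IsNonElementary G)
    {C : ℝ} {h : G} {x : Y} (hh : IsContractingAxis C h x) (o : Y) :
    0 < criticalExponent o (univ : Set G) := by
  obtain ⟨τ, L, K, hPP⟩ := hh.exists_isPingPong hY hG o
  have := hh.infinite_quotient hY hG
  obtain ⟨q, hq⟩ := exists_ne (QuotientGroup.mk 1 : G ⧸ commensuratingSubgroup h)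
  obtain ⟨g, rfl⟩ := QuotientGroup.mk_surjective q
  have hg : g ∉ commensuratingSubgroup h := fun hmem =>
    hq (QuotientGroup.eq.2 (by simpa using inv_mem hmem))
  obtain ⟨N, hN⟩ := exists_nat_gt (2 * τ + 6 * C)
  obtain ⟨m, hm, hcard⟩ := hh.exists_lt_ncard_orbitAnnulus hg o K N
  have hfin := finite_orbitAnnulus G o m
  obtain ⟨X, f, B, -, hBc, -, hB⟩ := hPP m (hN.trans_le (by exact_mod_cast hm)) hfin.toFinset
    (by simp)
  -- An annulus with more than `K` elements leaves two letters, so the exponent is at least `log 2 /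
  -- M`.
  rw [← ncard_eq_toFinset_card _ hfin] at hBc
  have hB2 : 2 ≤ B.card := by
    by_contra hlt
    have : K * B.card ≤ K * 1 := Nat.mul_le_mul_left K (by omega)
    omega
  obtain ⟨M, hM⟩ := exists_nat_ge ((m : ℝ) + 1 + dist o (f • o))
  have hM0 : (0 : ℝ) < M := by
    have := dist_nonneg (x := o) (y := f • o)
    have : (0 : ℝ) ≤ m := Nat.cast_nonneg m
    linarith
  have hle := hB.le_criticalExponent hY (a := Real.log 2 / M) hM (by
    rw [div_mul_cancel₀ _ hM0.ne', Real.exp_log two_pos]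
    exact_mod_cast hB2)
  refine lt_of_lt_of_le ?_ (hle.trans (criticalExponent_mono o (subset_univ _)))
  exact_mod_cast div_pos (Real.log_pos one_lt_two) hM0

/-- There are ping-pong semigroups with critical exponent close to, but smaller than, that of the
group. -/
theorem IsContractingAxis.exists_isPingPong_criticalExponent (hY : IsGeodesicSpace Y)
    (hG : IsNonElementary G) {C : ℝ} {h : G} {x : Y} (hh : IsContractingAxis C h x) (o : Y) {a : ℝ}
    (ha0 : 0 < a) (ha : (a : EReal) < criticalExponent o (univ : Set G)) :
    ∃ (τ ℓ : ℝ) (X : Set Y) (f : G) (A : Set G), A.Nonempty ∧ IsPingPong o C τ ℓ X f A ∧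
      (a : EReal) ≤ criticalExponent o (Subsemigroup.closure (altGenerators f A) : Set G) ∧
      criticalExponent o (Subsemigroup.closure (altGenerators f A) : Set G) <
        criticalExponent o (univ : Set G) := by
  obtain ⟨τ, L, K, hPP⟩ := hh.exists_isPingPong hY hG o
  obtain ⟨c, hbc, hc⟩ := EReal.lt_iff_exists_real_btwn.1 ha
  obtain ⟨b, hab, hbc⟩ := exists_between (show a < c by exact_mod_cast hbc)
  obtain ⟨N₀, hN₀⟩ := exists_nat_gt (2 * τ + 6 * C)
  -- `N₁` serves the upper bound, with `log 2` from rounding up `exp (b m)`; `N₂` serves the lower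
  -- bound, with `2` from the width of the annulus and the rounding of `|L|`.
  obtain ⟨N₁, hN₁⟩ := exists_nat_gt ((Real.log 2 + c * (2 * τ + 6 * C)) / (c - b))
  obtain ⟨N₂, hN₂⟩ := exists_nat_gt ((Real.log K + a * (|L| + 2)) / (b - a))
  obtain ⟨m, hm, hcard⟩ := exists_exp_lt_ncard_orbitAnnulus G o (ha0.trans hab)
    (lt_trans (by exact_mod_cast hbc) hc) (max N₀ (max N₁ N₂))
  have hm0 : (N₀ : ℝ) ≤ m := by exact_mod_cast (le_max_left _ _).trans hm
  have hm1 : (N₁ : ℝ) ≤ m := by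
    exact_mod_cast ((le_max_left _ _).trans (le_max_right _ _)).trans hm
  have hm2 : (N₂ : ℝ) ≤ m := by
    exact_mod_cast ((le_max_right _ _).trans (le_max_right _ _)).trans hm
  have hfin := finite_orbitAnnulus G o m
  rw [ncard_eq_toFinset_card _ hfin] at hcard
  -- Truncation to `⌈exp (b m)⌉` elements keeps the exponent below `c`.
  obtain ⟨A, hA, hAc⟩ := Finset.exists_subset_card_eq
    (Nat.ceil_le.2 hcard.le : ⌈Real.exp (b * m)⌉₊ ≤ hfin.toFinset.card)
  obtain ⟨X, f, B, hBA, hBc, hL, hB⟩ := hPP m (hN₀.trans_le hm0) A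
    (fun g hg => by simpa using hA hg)
  have hexp : Real.exp (b * m) ≤ K * B.card := by
    refine (Nat.le_ceil _).trans ?_
    rw [← hAc]
    exact_mod_cast hBc
  have hKB : (0 : ℝ) < K * B.card := (Real.exp_pos _).trans_le hexp
  have hB0 : (0 : ℝ) < B.card := pos_of_mul_pos_right hKB (Nat.cast_nonneg K)
  have hK0 : (0 : ℝ) < K := pos_of_mul_pos_left hKB hB0.le
  have hBne : B.Nonempty := Finset.card_pos.1 (by exact_mod_cast hB0)
  refine ⟨τ, m, X, f, B, by simpa using hBne, hB, ?_, ?_⟩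
  · have hM : (m : ℝ) + 1 + dist o (f • o) ≤ (m + 1 + ⌈|L|⌉₊ : ℕ) := by
      push_cast
      linarith [Nat.le_ceil |L|, le_abs_self L]
    refine hB.le_criticalExponent hY hM ?_
    rw [← Real.le_log_iff_exp_le hB0]
    have h1 : b * m ≤ Real.log K + Real.log B.card := by
      rw [← Real.log_mul hK0.ne' hB0.ne', Real.le_log_iff_exp_le hKB]
      exact hexp
    have h2 : Real.log K + a * (|L| + 2) ≤ m * (b - a) := by
      rw [← div_le_iff₀ (sub_pos.2 hab)]
      linarith
    have h3 : a * ((m + 1 + ⌈|L|⌉₊ : ℕ) : ℝ) ≤ a * (m + (|L| + 2)) := by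
      push_cast
      refine mul_le_mul_of_nonneg_left ?_ ha0.le
      linarith [Nat.ceil_lt_add_one (abs_nonneg L)]
    linarith
  · refine (hB.criticalExponent_le hY hBne (a := c) ?_).trans_lt hc
    have h1 : (B.card : ℝ) ≤ 2 * Real.exp (b * m) := by
      have h2 : B.card ≤ ⌈Real.exp (b * m)⌉₊ := hAc ▸ Finset.card_le_card hBA
      have h3 := Nat.ceil_lt_add_one (Real.exp_pos (b * m)).le
      have h4 : 1 ≤ Real.exp (b * m) :=
        Real.one_le_exp (mul_nonneg (ha0.trans hab).le (Nat.cast_nonneg m))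
      have h5 : (B.card : ℝ) ≤ ⌈Real.exp (b * m)⌉₊ := by exact_mod_cast h2
      linarith
    have h2 : Real.log B.card ≤ Real.log 2 + b * m := by
      refine (Real.log_le_log hB0 h1).trans ?_
      rw [Real.log_mul two_ne_zero (Real.exp_pos _).ne', Real.log_exp]
    have h3 : Real.log 2 + c * (2 * τ + 6 * C) < m * (c - b) := by
      rw [← div_lt_iff₀ (sub_pos.2 hbc)]
      linarith
    linarith

end Construction

/-! ### The theorem -/

theorem mainTheorem1 {G Y : Type*} [Group G] [MetricSpace Y] [ProperSpace Y] [MulAction G Y]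
    [IsIsometricSMul G Y] [ProperlyDiscontinuousSMul G Y]
    (hG : IsNonElementary G) (hY : IsGeodesicSpace Y)
    (hcontr : ∃ h : G, IsContractingElement Y h) (o : Y) :
    ∃ Γ : ℕ → Subsemigroup G,
      (∀ n, criticalExponent o (Γ n : Set G) < criticalExponent o (Set.univ : Set G)) ∧
      Tendsto (fun n => criticalExponent o (Γ n : Set G)) atTop
        (𝓝 (criticalExponent o (Set.univ : Set G))) ∧
      ∀ n, ∃ S : Set G, IsFreeSemigroupOn (Γ n) S ∧
        (semigroupCayleyGraph (Γ n) S).IsTree ∧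
        IsQuasiIsometricEmbedding
          (fun g h => ((semigroupCayleyGraph (Γ n) S).dist g h : ℝ)) (fun g => (g : G) • o) ∧
        ∀ σ : S → ℝ → Y, IsGeodesicChoice o S σ →
          ∃ c : ℝ, 1 ≤ c ∧ ∃ C : ℝ, 1 ≤ C ∧ ∀ b : ℕ → S,
            IsQuasiGeodesicPath c (branchPath o σ b) (Set.Ici 0) ∧
            IsContractingWith C (branchPath o σ b '' Set.Ici 0) := by
  obtain ⟨h, hh⟩ := hcontr
  obtain ⟨C, x, hh⟩ := hh.exists_isContractingAxis
  -- The targets stay in `(0, ω(G))`; this also covers `ω(G) = ∞`.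
  obtain ⟨u, -, hu, hlim⟩ := exists_seq_strictMono_tendsto' (hh.criticalExponent_pos hY hG o)
  have hex : ∀ n, ∃ (τ ℓ : ℝ) (X : Set Y) (f : G) (A : Set G), A.Nonempty ∧
      IsPingPong o C τ ℓ X f A ∧
      u n ≤ criticalExponent o (Subsemigroup.closure (altGenerators f A) : Set G) ∧
      criticalExponent o (Subsemigroup.closure (altGenerators f A) : Set G) <
        criticalExponent o (univ : Set G) := by
    intro n
    obtain ⟨a, hua, ha⟩ := EReal.lt_iff_exists_real_btwn.1 (hu n).2
    have ha0 : 0 < a := by exact_mod_cast (hu n).1.trans hua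
    obtain ⟨τ, ℓ, X, f, A, hA, hP, hle, hlt⟩ :=
      hh.exists_isPingPong_criticalExponent hY hG o ha0 ha
    exact ⟨τ, ℓ, X, f, A, hA, hP, hua.le.trans hle, hlt⟩
  choose τ ℓ X f A hA hP hle hlt using hex
  refine ⟨fun n => Subsemigroup.closure (altGenerators (f n) (A n)), hlt, ?_, fun n =>
    ⟨altGenerators (f n) (A n), (hP n).isFreeSemigroupOn hY (hA n), (hP n).isTree_altCayleyGraph hY,
      (hP n).isQuasiIsometricEmbedding hY, fun σ hσ => ?_⟩⟩
  · exact tendsto_of_tendsto_of_tendsto_of_le_of_le hlim tendsto_const_nhds hle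
      fun n => (hlt n).le
  · obtain ⟨c, hc, hc'⟩ := (hP n).isQuasiGeodesicPath_branchPath hY
    obtain ⟨D, hD, hD'⟩ := (hP n).isContractingWith_branchPath hY
    exact ⟨c, hc, D, hD, fun b => ⟨hc' σ hσ b, hD' σ hσ b⟩⟩
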